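/- Let $N\ge 3$, $0\le\mu\le (N-2)^2/8$, $2^*=\frac{2N}{N-2}$, $\beta=\frac{N-2}{4}$ and $K(y)=e^{|y|^2/4}$ on $\mathbb{R}^N$. Write $\|v\|_{K,2}=\left(\int_{\mathbb{R}^N}|v|^2K\,dy\right)^{1/2}$, let $L^2_K$ be the corresponding Hilbert space with inner product $(f,g)_K=\int_{\mathbb{R}^N} f g\,K\,dy$ (with $f\cdot g$ for vector fields), and let $X\subset L^2_K$ be the completion of $C_c^\infty(\mathbb{R}^N)$ with respect to the norm $\|\nabla v\|_{K,2}$. For $v\in X$ and $\delta\in\mathbb{R}$ set $$A(v)=\int_{\mathbb{R}^N}\Big(|\nabla v|^2-\mu\frac{|v|^2}{|y|^2}-\beta|v|^2\Big)K\,dy,\qquad B(v)=\int_{\mathbb{R}^N}|v|^{2^*}K\,dy,$$ $$E_K(v)=\tfrac12A(v)-\tfrac1{2^*}B(v),\qquad D_K(v)=A(v)-B(v),\qquad D_{K,\delta}(v)=\delta A(v)-B(v),$$ $$d=\inf\{E_K(v): v\in X\setminus\{0\},\ D_K(v)=0\},\qquad d(\delta)=\inf\{E_K(v): v\in X,\ \|\nabla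 v\|_{K,2}\ne0,\ D_{K,\delta}(v)=0\}.$$ For $v_0\in X$, a global weak solution of $$v_s-\Delta v-\tfrac12 y\cdot\nabla v=\beta v+\frac{\mu v}{|y|^2}+|v|^{2^*-2}v\ \text{ in }\mathbb{R}^N\times(0,\infty),\qquad v|_{s=0}=v_0,$$ is a curve $v\in C([0,\infty);X)$ with $v(0)=v_0$ such that, for every $0<S<\infty$, $v\in L^\infty(0,S;X)$, the weak time derivative satisfies $v_s\in L^2(0,S;L^2_K)$, and for all $w\in X$ and $s\in(0,S)$ $$\int_0^s\big[(v_s,w)_K+(\nabla v,\nabla w)_K\big]\,d\tau=\int_0^s\Big(|v|^{2^*-2}v+\mu\frac{v}{|y|^2}+\beta v,\;w\Big)_K\,d\tau .$$ Theorem (decay rate). Let $v_0\in X$ with $E_K(v_0)<d$ and $D_K(v_0)>0$, and let $\delta_1<\delta_2$ be the two roots of the equation $d(\delta)=E_K(v_0)$. Then every global weak solution $v$ of the problem above satisfies $$\|v(s)\|_{K,2}^2\le\|v_0\|_{K,2}^2\,e^{-\frac12(1-\delta_1)s}\qquad\text{for all } s\ge0 .$$ -/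

import Mathlib

open MeasureTheory Set
open scoped ContDiff

noncomputable section

namespace HardySobolev

/-- Euclidean space `ℝ^N`. -/
abbrev Eucl (N : ℕ) : Type := EuclideanSpace ℝ (Fin N)

/-- The weight `K(y) = exp(|y|² / 4)`. -/
def weight (N : ℕ) (y : Eucl N) : ℝ := Real.exp (‖y‖ ^ 2 / 4)

/-- The measure `K(y) dy`. -/
def measK (N : ℕ) : Measure (Eucl N) :=
  (volume : Measure (Eucl N)).withDensity (fun y => ENNReal.ofReal (weight N y))

/-- The critical Sobolev exponent `2* = 2N / (N - 2)`. -/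
def twoStar (N : ℕ) : ℝ := 2 * (N : ℝ) / ((N : ℝ) - 2)

/-- The constant `β = (N - 2) / 4 = 1 / (p - 1)`, where `p = 2* - 1`. -/
def beta (N : ℕ) : ℝ := ((N : ℝ) - 2) / 4

/-- The space `L²_K(ℝ^N)`; its norm is `‖·‖_{K,2}`. -/
abbrev L2K (N : ℕ) : Type := Lp ℝ 2 (measK N)

/-- Square integrable vector fields with respect to `K(y) dy`. -/
abbrev L2KVec (N : ℕ) : Type := Lp (Eucl N) 2 (measK N)

/-- The pairs `(φ, ∇φ)` with `φ ∈ C_c^∞(ℝ^N)`, as a subspace of `L²_K × L²_K`. -/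
def testGraph (N : ℕ) : Submodule ℝ (L2K N × L2KVec N) where
  carrier := {p | ∃ φ : Eucl N → ℝ, ContDiff ℝ ∞ φ ∧ HasCompactSupport φ ∧
    p.1 =ᵐ[measK N] φ ∧ p.2 =ᵐ[measK N] gradient φ}
  add_mem' := by
    rintro p q ⟨φ, hφ, hφc, hp1, hp2⟩ ⟨ψ, hψ, hψc, hq1, hq2⟩
    refine ⟨φ + ψ, hφ.add hψ, hφc.add hψc, ?_, ?_⟩
    · filter_upwards [Lp.coeFn_add p.1 q.1, hp1, hq1] with y h h1 h2
      simp only [Prod.fst_add, h, Pi.add_apply, h1, h2]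
    · filter_upwards [Lp.coeFn_add p.2 q.2, hp2, hq2] with y h h1 h2
      have e1 : DifferentiableAt ℝ φ y := hφ.differentiable (by simp) y
      have e2 : DifferentiableAt ℝ ψ y := hψ.differentiable (by simp) y
      simp only [Prod.snd_add, h, Pi.add_apply, h1, h2, gradient, fderiv_add e1 e2, map_add]
  zero_mem' := by
    refine ⟨0, contDiff_const, HasCompactSupport.zero, Lp.coeFn_zero _ _ _, ?_⟩
    filter_upwards [Lp.coeFn_zero (Eucl N) 2 (measK N)] with y h
    have : gradient (0 : Eucl N → ℝ) y = 0 := by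
      simp [gradient]
    rw [this]
    exact h
  smul_mem' := by
    rintro c p ⟨φ, hφ, hφc, hp1, hp2⟩
    refine ⟨c • φ, hφ.const_smul c, hφc.smul_left (f := fun _ => c), ?_, ?_⟩
    · filter_upwards [Lp.coeFn_smul c p.1, hp1] with y h h1
      simp only [Prod.smul_fst, h, Pi.smul_apply, h1]
    · filter_upwards [Lp.coeFn_smul c p.2, hp2] with y h h1
      have e1 : DifferentiableAt ℝ φ y := hφ.differentiable (by simp) y
      simp only [Prod.smul_snd, h, Pi.smul_apply, h1, gradient, fderiv_const_smul e1, map_smul]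

/-- The space `X`: the completion of `C_c^∞(ℝ^N)` for the norm `‖∇v‖_{K,2}`, realized inside
`L²_K`. An element is a function `v ∈ L²_K` together with its gradient `∇v ∈ L²_K`, the pair being
a limit of pairs `(φ, ∇φ)` with `φ ∈ C_c^∞(ℝ^N)`. (By the Poincaré inequality
`(N/2) ‖φ‖_{K,2}² ≤ ‖∇φ‖_{K,2}²`, Cauchy sequences for `‖∇φ‖_{K,2}` and for the graph norm
coincide.) -/
def X (N : ℕ) : Submodule ℝ (L2K N × L2KVec N) := (testGraph N).topologicalClosure

/-- The function underlying an element of `X`, as an element of `L²_K`. -/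
def fn {N : ℕ} (v : X N) : L2K N := v.1.1

/-- The gradient of an element of `X`, as an element of `L²_K`; `‖grad v‖ = ‖∇v‖_{K,2}` is the
norm of `X`. -/
def grad {N : ℕ} (v : X N) : L2KVec N := v.1.2

/-- `A(v) = ∫ (|∇v|² - μ |v|² / |y|² - β |v|²) K dy`. -/
def quadA (N : ℕ) (μ : ℝ) (v : X N) : ℝ :=
  ∫ y, (‖grad v y‖ ^ 2 - μ * (|fn v y| ^ 2 / ‖y‖ ^ 2) - beta N * |fn v y| ^ 2) ∂(measK N)

/-- `B(v) = ∫ |v|^{2*} K dy`. -/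
def funB (N : ℕ) (v : X N) : ℝ := ∫ y, |fn v y| ^ (twoStar N) ∂(measK N)

/-- The energy `E_K(v) = A(v) / 2 - B(v) / 2*`. -/
def energy (N : ℕ) (μ : ℝ) (v : X N) : ℝ :=
  1 / 2 * quadA N μ v - 1 / twoStar N * funB N v

/-- `D_K(v) = A(v) - B(v)`. -/
def nehari (N : ℕ) (μ : ℝ) (v : X N) : ℝ := quadA N μ v - funB N v

/-- `D_{K,δ}(v) = δ A(v) - B(v)`. -/
def nehariMod (N : ℕ) (μ δ : ℝ) (v : X N) : ℝ := δ * quadA N μ v - funB N v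

/-- The Nehari manifold `{v ∈ X : D_K(v) = 0, v ≠ 0}`. -/
def nehariSet (N : ℕ) (μ : ℝ) : Set (X N) := {v | nehari N μ v = 0 ∧ v ≠ 0}

/-- The modified Nehari manifold `{v ∈ X : D_{K,δ}(v) = 0, ‖∇v‖_{K,2} ≠ 0}`. -/
def nehariSetMod (N : ℕ) (μ δ : ℝ) : Set (X N) := {v | nehariMod N μ δ v = 0 ∧ ‖grad v‖ ≠ 0}

/-- The depth `d` of the potential well: the infimum of `E_K` over the Nehari manifold, taken in
the extended reals. -/
def depth (N : ℕ) (μ : ℝ) : EReal := ⨅ v ∈ nehariSet N μ, (energy N μ v : EReal)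

/-- `d(δ)`: the infimum of `E_K` over the modified Nehari manifold, taken in the extended reals. -/
def depthMod (N : ℕ) (μ δ : ℝ) : EReal := ⨅ v ∈ nehariSetMod N μ δ, (energy N μ v : EReal)

/-- `w` is the weak derivative of the `L²_K`-valued curve `u` on the time interval `(0, S)`. -/
def IsWeakTimeDeriv (N : ℕ) (S : ℝ) (u w : ℝ → L2K N) : Prop :=
  ∀ φ : ℝ → ℝ, ContDiff ℝ ∞ φ → HasCompactSupport φ → tsupport φ ⊆ Ioo 0 S →
    ∫ s in Ioo 0 S, deriv φ s • u s = -∫ s in Ioo 0 S, φ s • w s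

/-- `v` is a weak solution on `ℝ^N × (0, S)`, with initial value `v₀ ∈ X`, of
`v_s - Δv - (1/2) y · ∇v = β v + μ v / |y|² + |v|^{2* - 2} v`:
it is a continuous curve in `X` (for the norm `‖∇v‖_{K,2}`), `v ∈ L^∞(0, S; X)`,
`v_s ∈ L²(0, S; L²_K)`, `v(0) = v₀`, and the equation holds when tested against any `w ∈ X` and
integrated over `(0, s)`. -/
structure IsWeakSolution (N : ℕ) (μ : ℝ) (v₀ : X N) (S : ℝ) (v : ℝ → X N) : Prop where
  initial : v 0 = v₀
  continuous : ContinuousOn (fun s => grad (v s)) (Ico 0 S)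
  bounded : MemLp (fun s => grad (v s)) ⊤ (volume.restrict (Ioo 0 S))
  equation : ∃ vs : ℝ → L2K N,
    MemLp vs 2 (volume.restrict (Ioo 0 S)) ∧
    IsWeakTimeDeriv N S (fun s => fn (v s)) vs ∧
    ∀ w : X N, ∀ s ∈ Ioo 0 S,
      ∫ τ in (0 : ℝ)..s, ((∫ y, vs τ y * fn w y ∂(measK N)) +
          ∫ y, inner ℝ (grad (v τ) y) (grad w y) ∂(measK N)) =
        ∫ τ in (0 : ℝ)..s, ∫ y, (|fn (v τ) y| ^ (twoStar N - 2) * fn (v τ) y +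
          μ * (fn (v τ) y / ‖y‖ ^ 2) + beta N * fn (v τ) y) * fn w y ∂(measK N)

/-- A global weak solution: a weak solution on `ℝ^N × (0, S)` for every finite `S > 0`. -/
def IsGlobalWeakSolution (N : ℕ) (μ : ℝ) (v₀ : X N) (v : ℝ → X N) : Prop :=
  ∀ S : ℝ, 0 < S → IsWeakSolution N μ v₀ S v

end HardySobolev

end

noncomputable section

namespace HardySobolev

/-! ### Weighted inequalities for test functions -/

/-! The problem is the gradient flow of `E_K` in `L²_K`. Testing the equation with the solution
itself gives `d/ds (‖v‖² / 2) = -D_K(v)`, so the decay rate comes from a lower bound of `D_K` by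
`‖v‖²` along the flow. If `B(v) ≤ δ₁ A(v)` and `δ₁ ≤ 1`, then `D_K(v) ≥ (1 - δ₁) A(v) ≥ (1 - δ₁)/2
‖v‖²`, the last step by the weighted Hardy and Poincaré inequalities (`norm_fn_sq_le_quadA`). Half
of this bound gives the claimed rate.

The inequality `B ≤ δ₁ A` holds wherever `E_K ≤ E_K(v₀)` and `D_K ≥ 0` (`funB_le_mul_quadA`):
otherwise a contraction `c v` lies on the modified Nehari manifold with energy strictly below
`d(δ₁)`. The sign `D_K ≥ 0` persists by connectedness of the time axis (`nehari_nonneg_of_curve`):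
below the depth `d` the functional `D_K` can vanish only at `0`, and it is nonnegative near `0`.

What remains is that the energy does not increase. The chain rule is not directly available, since
`v_s` is only in `L²_K` while `E_K` is differentiable on `X`. It is replaced by local semiconvexity
(`exists_semiconvex`): near `z`, `E_K'(u)(z - u) ≤ E_K(z) - E_K(u) + M ‖u - z‖²` with the norm of
`L²_K`. Since the left side is the time derivative of `‖u - z‖² / 2` along the flow, an energy rise
just after `u = z` contradicts a Gronwall argument (`antitoneOn_energy_of_flow`). Semiconvexity at
the critical exponent holds because `|z|^{2* - 2}` is a bounded potential plus one small enough to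
be absorbed by the coercivity of `A`. -/

lemma weight_pos (N : ℕ) (y : Eucl N) : 0 < weight N y := Real.exp_pos _

lemma contDiff_weight (N : ℕ) {n : WithTop ℕ∞} : ContDiff ℝ n (weight N) :=
  Real.contDiff_exp.comp ((contDiff_norm_sq ℝ).div_const 4)

lemma continuous_weight (N : ℕ) : Continuous (weight N) :=
  (contDiff_weight N (n := 0)).continuous

lemma measurable_ofReal_weight (N : ℕ) : Measurable (fun y => ENNReal.ofReal (weight N y)) :=
  (continuous_weight N).measurable.ennreal_ofReal

instance (N : ℕ) : IsLocallyFiniteMeasure (measK N) :=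
  IsLocallyFiniteMeasure.withDensity_ofReal (continuous_weight N)

lemma integral_measK {N : ℕ} (f : Eucl N → ℝ) :
    ∫ y, f y ∂(measK N) = ∫ y, weight N y * f y := by
  rw [measK, integral_withDensity_eq_integral_toReal_smul (measurable_ofReal_weight N) (by simp)]
  simp [ENNReal.toReal_ofReal (weight_pos N _).le]

lemma hasFDerivAt_exp_mul_norm_sq {N : ℕ} (c : ℝ) (y : Eucl N) :
    HasFDerivAt (fun y : Eucl N => Real.exp (c * ‖y‖ ^ 2))
      (Real.exp (c * ‖y‖ ^ 2) • c • (2 : ℝ) • innerSL ℝ y) y := by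
  have h : HasFDerivAt (fun y : Eucl N => ‖y‖ ^ 2) ((2 : ℝ) • innerSL ℝ y) y := by
    have := (hasStrictFDerivAt_norm_sq y).hasFDerivAt
    rwa [← Nat.cast_smul_eq_nsmul ℝ] at this
  exact (h.const_mul c).exp

lemma fderiv_weight_apply_self {N : ℕ} (y : Eucl N) :
    fderiv ℝ (weight N) y y = weight N y * (‖y‖ ^ 2 / 2) := by
  have h := (hasFDerivAt_exp_mul_norm_sq (1 / 4) y).fderiv
  have hw : weight N = fun y => Real.exp (1 / 4 * ‖y‖ ^ 2) := by
    funext y; simp [weight]; ring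
  rw [hw, h]
  simp
  ring

/-- The radial integration by parts formula `∫ y · ∇g = -N ∫ g`. -/
lemma integral_fderiv_apply_self {N : ℕ} {g : Eucl N → ℝ} (hg : ContDiff ℝ 1 g)
    (hc : HasCompactSupport g) : ∫ y, fderiv ℝ g y y = -(N * ∫ y, g y) := by
  have hd : Continuous (fderiv ℝ g) := hg.continuous_fderiv (by simp)
  have hint : ∀ i : Fin N, Integrable
      (fun y : Eucl N => y i * fderiv ℝ g y (EuclideanSpace.single i 1)) := fun i => by
    refine Continuous.integrable_of_hasCompactSupport (by fun_prop) ?_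
    refine HasCompactSupport.mul_left (f := fun y : Eucl N => y i) ?_
    exact (hc.fderiv ℝ).comp_left (g := fun L : Eucl N →L[ℝ] ℝ => L (EuclideanSpace.single i 1))
      (by simp)
  have key : ∀ i : Fin N,
      ∫ y : Eucl N, y i * fderiv ℝ g y (EuclideanSpace.single i 1) = -∫ y, g y := fun i => by
    have hp : ∀ y : Eucl N, fderiv ℝ (fun y : Eucl N => y i) y = EuclideanSpace.proj i := fun y =>
      (EuclideanSpace.proj (𝕜 := ℝ) i : Eucl N →L[ℝ] ℝ).fderiv
    rw [integral_mul_fderiv_eq_neg_fderiv_mul_of_integrable]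
    · simp [hp]
    · simpa [hp] using hg.continuous.integrable_of_hasCompactSupport hc
    · exact hint i
    · exact (Continuous.integrable_of_hasCompactSupport (by fun_prop)
        (HasCompactSupport.mul_left (f := fun y : Eucl N => y i) hc))
    · intro y _
      exact (EuclideanSpace.proj (𝕜 := ℝ) i : Eucl N →L[ℝ] ℝ).differentiableAt
    · intro y _
      exact hg.differentiable (by simp) y
  have hsum : ∀ y : Eucl N, fderiv ℝ g y y =
      ∑ i, y i * fderiv ℝ g y (EuclideanSpace.single i 1) := fun y => by
    have h := congrArg (fderiv ℝ g y) ((EuclideanSpace.basisFun (Fin N) ℝ).sum_repr y)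
    simpa [map_sum] using h.symm
  simp_rw [hsum]
  rw [integral_finsetSum _ (fun i _ => hint i)]
  simp [key]

/-- The weighted Hardy-type inequality obtained by expanding `∫ |∇φ + H φ y|² K ≥ 0`. -/
lemma integral_mul_sq_le_integral_norm_gradient_sq {N : ℕ} {φ H : Eucl N → ℝ}
    (hφ : ContDiff ℝ ∞ φ) (hc : HasCompactSupport φ) (hH : ContDiff ℝ 1 H) :
    ∫ y, (N * H y + fderiv ℝ H y y + ‖y‖ ^ 2 * H y / 2 - ‖y‖ ^ 2 * H y ^ 2) * φ y ^ 2 ∂(measK N) ≤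
      ∫ y, ‖gradient φ y‖ ^ 2 ∂(measK N) := by
  have hφ1 : ContDiff ℝ 1 φ := hφ.of_le (by exact_mod_cast le_top)
  have hW : ContDiff ℝ 1 (weight N) := contDiff_weight N
  have hWc := hW.continuous
  have hφc := hφ1.continuous
  have hHc := hH.continuous
  have hdφ : Continuous (fderiv ℝ φ) := hφ1.continuous_fderiv (by simp)
  have hdH : Continuous (fderiv ℝ H) := hH.continuous_fderiv (by simp)
  set g : Eucl N → ℝ := fun y => φ y ^ 2 * (H y * weight N y) with hgdef
  have hg : ContDiff ℝ 1 g := (hφ1.pow 2).mul (hH.mul hW)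
  have hφ2c : HasCompactSupport (fun y => φ y ^ 2) :=
    hc.comp_left (g := fun x : ℝ => x ^ 2) (by simp)
  have hgc : HasCompactSupport g := hφ2c.mul_right
  have hdg : Continuous (fderiv ℝ g) := hg.continuous_fderiv (by simp)
  have hgrad : ∀ y, ‖gradient φ y‖ = ‖fderiv ℝ φ y‖ := fun y => by simp [gradient]
  have hgd : ∀ y, fderiv ℝ g y y = 2 * φ y * fderiv ℝ φ y y * (H y * weight N y) +
      φ y ^ 2 * (fderiv ℝ H y y * weight N y + H y * (weight N y * (‖y‖ ^ 2 / 2))) := fun y => by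
    have e1 : HasFDerivAt φ (fderiv ℝ φ y) y := (hφ1.differentiable (by simp) y).hasFDerivAt
    have e2 : HasFDerivAt H (fderiv ℝ H y) y := (hH.differentiable (by simp) y).hasFDerivAt
    have e3 : HasFDerivAt (weight N) (fderiv ℝ (weight N) y) y :=
      (hW.differentiable (by simp) y).hasFDerivAt
    have e4 : fderiv ℝ g y = _ := ((e1.pow 2).mul (e2.mul e3)).fderiv
    rw [e4]
    simp [fderiv_weight_apply_self]
    ring
  rw [integral_measK, integral_measK]
  have i1 : Integrable (fun y => weight N y *
      ((N * H y + fderiv ℝ H y y + ‖y‖ ^ 2 * H y / 2 - ‖y‖ ^ 2 * H y ^ 2) * φ y ^ 2)) :=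
    Continuous.integrable_of_hasCompactSupport (by fun_prop) (hφ2c.mul_left.mul_left)
  have i2 : Integrable (fun y => weight N y * ‖gradient φ y‖ ^ 2) := by
    simp_rw [hgrad]
    exact Continuous.integrable_of_hasCompactSupport (by fun_prop)
      (((hc.fderiv ℝ).comp_left (g := fun L : Eucl N →L[ℝ] ℝ => ‖L‖ ^ 2) (by simp)).mul_left)
  have i3 : Integrable (fun y => fderiv ℝ g y y) := by
    refine Continuous.integrable_of_hasCompactSupport (by fun_prop) ?_
    exact (hgc.fderiv ℝ).mono (fun y hy => by
      simp only [Function.mem_support] at hy ⊢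
      contrapose! hy
      simp [hy])
  have i4 : Integrable g := hg.continuous.integrable_of_hasCompactSupport hgc
  have h0 := integral_fderiv_apply_self hg hgc
  -- The integrand is `K |∇φ + H φ y|²`: its cross term is the part of `y · ∇g` that differentiates
  -- `φ²`. The added terms `y · ∇g + N g` integrate to zero.
  have hpos : 0 ≤ ∫ y, (weight N y * ‖gradient φ y‖ ^ 2 - weight N y *
      ((N * H y + fderiv ℝ H y y + ‖y‖ ^ 2 * H y / 2 - ‖y‖ ^ 2 * H y ^ 2) * φ y ^ 2)
      + fderiv ℝ g y y + N * g y) := by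
    refine integral_nonneg fun y => ?_
    have hin : inner ℝ (gradient φ y) y = fderiv ℝ φ y y := by simp [gradient]
    have hsq := norm_add_sq_real (gradient φ y) ((H y * φ y) • y)
    rw [inner_smul_right, hin, norm_smul, mul_pow, Real.norm_eq_abs, sq_abs] at hsq
    have h1 : 0 ≤ weight N y * ‖gradient φ y + (H y * φ y) • y‖ ^ 2 :=
      mul_nonneg (weight_pos N y).le (by positivity)
    rw [hsq] at h1
    simp only [Pi.zero_apply]
    rw [hgd]
    simp only [hgdef]
    linarith
  have i12 : Integrable (fun y => weight N y * ‖gradient φ y‖ ^ 2 - weight N y *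
      ((N * H y + fderiv ℝ H y y + ‖y‖ ^ 2 * H y / 2 - ‖y‖ ^ 2 * H y ^ 2) * φ y ^ 2)) := i2.sub i1
  have i123 : Integrable (fun y => weight N y * ‖gradient φ y‖ ^ 2 - weight N y *
      ((N * H y + fderiv ℝ H y y + ‖y‖ ^ 2 * H y / 2 - ‖y‖ ^ 2 * H y ^ 2) * φ y ^ 2)
      + fderiv ℝ g y y) := i12.add i3
  rw [integral_add i123 (i4.const_mul _), integral_add i12 i3,
    integral_sub i2 i1, h0, integral_const_mul] at hpos
  linarith

lemma eLpNorm_two_le_of_integral_sq_le {α β E F : Type*} [MeasurableSpace α] [MeasurableSpace β]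
    [NormedAddCommGroup E] [NormedAddCommGroup F] {μ : Measure α} {ν : Measure β}
    {f : α → E} {g : β → F} {C : ℝ} (hC : 0 ≤ C) (hf : MemLp f 2 μ) (hg : MemLp g 2 ν)
    (h : ∫ x, ‖f x‖ ^ 2 ∂μ ≤ C ^ 2 * ∫ x, ‖g x‖ ^ 2 ∂ν) :
    eLpNorm f 2 μ ≤ ENNReal.ofReal C * eLpNorm g 2 ν := by
  rw [hf.eLpNorm_eq_integral_rpow_norm (by simp) (by simp),
    hg.eLpNorm_eq_integral_rpow_norm (by simp) (by simp), ← ENNReal.ofReal_mul hC]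
  refine ENNReal.ofReal_le_ofReal ?_
  simp only [ENNReal.toReal_ofNat, Real.rpow_two, ← one_div, ← Real.sqrt_eq_rpow]
  rw [← Real.sqrt_sq hC, ← Real.sqrt_mul (by positivity)]
  exact Real.sqrt_le_sqrt h

section Test

variable {N : ℕ} {φ : Eucl N → ℝ}

lemma continuous_gradient (hφ : ContDiff ℝ ∞ φ) : Continuous (gradient φ) :=
  (InnerProductSpace.toDual ℝ (Eucl N)).symm.continuous.comp (hφ.continuous_fderiv (by simp))

lemma memLp_gradient (hφ : ContDiff ℝ ∞ φ) (hc : HasCompactSupport φ) (p : ENNReal) :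
    MemLp (gradient φ) p (measK N) :=
  (continuous_gradient hφ).memLp_of_hasCompactSupport
    ((hc.fderiv ℝ).comp_left (g := (InnerProductSpace.toDual ℝ (Eucl N)).symm) (by simp))

/-- Poincaré inequality for test functions. -/
lemma poincare_test (hφ : ContDiff ℝ ∞ φ) (hc : HasCompactSupport φ) :
    (N : ℝ) / 2 * ∫ y, φ y ^ 2 ∂(measK N) ≤ ∫ y, ‖gradient φ y‖ ^ 2 ∂(measK N) := by
  -- For constant `H` the coefficient is `N H + |y|² (H/2 - H²)`; `H = 1/2` removes the quadratic
  -- term, while `H = 1/4` makes its factor `1/16`, the largest possible.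
  have h := integral_mul_sq_le_integral_norm_gradient_sq hφ hc (H := fun _ => 1 / 2) contDiff_const
  rw [← integral_const_mul]
  refine le_of_eq_of_le (integral_congr_ae (.of_forall fun y => ?_)) h
  simp only [fderiv_fun_const, Pi.zero_apply, zero_apply]
  ring

lemma integral_norm_sq_mul_sq_le (hφ : ContDiff ℝ ∞ φ) (hc : HasCompactSupport φ) :
    ∫ y, ‖y‖ ^ 2 * φ y ^ 2 ∂(measK N) ≤ 16 * ∫ y, ‖gradient φ y‖ ^ 2 ∂(measK N) := by
  have h := integral_mul_sq_le_integral_norm_gradient_sq hφ hc (H := fun _ => 1 / 4) contDiff_const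
  have hφc := hφ.continuous
  have hφ2c : HasCompactSupport (fun y => φ y ^ 2) :=
    hc.comp_left (g := fun x : ℝ => x ^ 2) (by simp)
  have h2 : ∫ y, 1 / 16 * (‖y‖ ^ 2 * φ y ^ 2) ∂(measK N) ≤
      ∫ y, ‖gradient φ y‖ ^ 2 ∂(measK N) := by
    refine le_trans (integral_mono ?_ ?_ fun y => ?_) h
    · exact Continuous.integrable_of_hasCompactSupport (by fun_prop) hφ2c.mul_left.mul_left
    · refine Continuous.integrable_of_hasCompactSupport ?_ hφ2c.mul_left
      simp only [fderiv_fun_const]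
      fun_prop
    · simp
      nlinarith [sq_nonneg (φ y), mul_nonneg (Nat.cast_nonneg (α := ℝ) N) (sq_nonneg (φ y))]
  rw [integral_const_mul] at h2
  linarith

/-- The Hardy choice `H = c / |y|²` is singular at the origin, so `|y|²` is replaced by `|y|² + ε`;
the constant obtained does not depend on `ε`. -/
lemma hardy_test_regularized (hN : 3 ≤ N) (hφ : ContDiff ℝ ∞ φ) (hc : HasCompactSupport φ)
    {ε : ℝ} (hε : 0 < ε) :
    ∫ y, φ y ^ 2 / (‖y‖ ^ 2 + ε) ∂(measK N) ≤
      (2 / ((N : ℝ) - 2)) ^ 2 * ∫ y, ‖gradient φ y‖ ^ 2 ∂(measK N) := by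
  have hN' : (0 : ℝ) < (N : ℝ) - 2 := by
    have : (3 : ℝ) ≤ N := by exact_mod_cast hN
    linarith
  have hpos : ∀ y : Eucl N, 0 < ‖y‖ ^ 2 + ε := fun y => by positivity
  -- This value maximizes `(N - 2) c - c²`, the coefficient of `|y|⁻²` when `ε = 0`; the maximum is
  -- `c²`.
  set c : ℝ := ((N : ℝ) - 2) / 2 with hcdef
  have hc0 : 0 < c := by positivity
  set H : Eucl N → ℝ := fun y => c * (‖y‖ ^ 2 + ε)⁻¹ with hHdef
  have hns : ContDiff ℝ 1 (fun y : Eucl N => ‖y‖ ^ 2 + ε) := (contDiff_norm_sq ℝ).add contDiff_const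
  have hH : ContDiff ℝ 1 H := contDiff_const.mul (hns.inv fun y => (hpos y).ne')
  have hHd : ∀ y, fderiv ℝ H y y = -(2 * c * ‖y‖ ^ 2 / (‖y‖ ^ 2 + ε) ^ 2) := fun y => by
    have h : HasFDerivAt (fun y : Eucl N => ‖y‖ ^ 2 + ε) (2 • innerSL ℝ y) y :=
      (hasStrictFDerivAt_norm_sq y).hasFDerivAt.add_const ε
    have h1 : HasFDerivAt H _ y :=
      (((hasDerivAt_inv (hpos y).ne').comp_hasFDerivAt y h).const_mul c)
    rw [h1.fderiv]
    simp
    ring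
  have h := integral_mul_sq_le_integral_norm_gradient_sq hφ hc hH
  have hφc := hφ.continuous
  have hφ2c : HasCompactSupport (fun y => φ y ^ 2) :=
    hc.comp_left (g := fun x : ℝ => x ^ 2) (by simp)
  have hHc := hH.continuous
  have hdH : Continuous (fderiv ℝ H) := hH.continuous_fderiv (by simp)
  have h2 : ∫ y, c ^ 2 * (φ y ^ 2 / (‖y‖ ^ 2 + ε)) ∂(measK N) ≤
      ∫ y, ‖gradient φ y‖ ^ 2 ∂(measK N) := by
    refine le_trans (integral_mono ?_ ?_ fun y => ?_) h
    · refine Continuous.integrable_of_hasCompactSupport ?_ ?_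
      · exact continuous_const.mul ((hφc.pow 2).div (by fun_prop) fun y => (hpos y).ne')
      · simp only [div_eq_mul_inv]
        exact hφ2c.mul_right.mul_left
    · exact Continuous.integrable_of_hasCompactSupport (by fun_prop) hφ2c.mul_left
    · simp only [hHd]
      have hr := hpos y
      have key : c ^ 2 / (‖y‖ ^ 2 + ε) ≤ N * H y + -(2 * c * ‖y‖ ^ 2 / (‖y‖ ^ 2 + ε) ^ 2) +
          ‖y‖ ^ 2 * H y / 2 - ‖y‖ ^ 2 * H y ^ 2 := by
        have hNc : (N : ℝ) = 2 * c + 2 := by rw [hcdef]; ring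
        simp only [hHdef]
        rw [hNc, ← sub_nonneg]
        have : (2 * c + 2) * (c * (‖y‖ ^ 2 + ε)⁻¹) + -(2 * c * ‖y‖ ^ 2 / (‖y‖ ^ 2 + ε) ^ 2) +
          ‖y‖ ^ 2 * (c * (‖y‖ ^ 2 + ε)⁻¹) / 2 - ‖y‖ ^ 2 * (c * (‖y‖ ^ 2 + ε)⁻¹) ^ 2 -
          c ^ 2 / (‖y‖ ^ 2 + ε) = ((c ^ 2 + 2 * c) * ε + ‖y‖ ^ 2 * c * (‖y‖ ^ 2 + ε) / 2)
            / (‖y‖ ^ 2 + ε) ^ 2 := by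
          field_simp
          ring
        rw [this]
        positivity
      calc c ^ 2 * (φ y ^ 2 / (‖y‖ ^ 2 + ε)) = c ^ 2 / (‖y‖ ^ 2 + ε) * φ y ^ 2 := by ring
        _ ≤ _ := mul_le_mul_of_nonneg_right key (sq_nonneg _)
  rw [integral_const_mul] at h2
  have h3 : (2 / ((N : ℝ) - 2)) = c⁻¹ := by rw [hcdef]; field_simp
  rw [h3, inv_pow, inv_mul_eq_div, le_div_iff₀ (by positivity)]
  linarith

lemma ae_ne_zero (hN : 3 ≤ N) : ∀ᵐ y ∂(measK N), y ≠ 0 := by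
  have : Nonempty (Fin N) := ⟨⟨0, by omega⟩⟩
  have h : ∀ᵐ y : Eucl N, y ≠ 0 := by
    rw [ae_iff]
    simp
  exact (withDensity_absolutelyContinuous volume _).ae_le h

/-- Hardy inequality for test functions. -/
lemma hardy_test (hN : 3 ≤ N) (hφ : ContDiff ℝ ∞ φ) (hc : HasCompactSupport φ) :
    eLpNorm (fun y => φ y / ‖y‖) 2 (measK N) ≤
      ENNReal.ofReal (2 / ((N : ℝ) - 2)) * eLpNorm (gradient φ) 2 (measK N) := by
  have hN' : (0 : ℝ) < (N : ℝ) - 2 := by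
    have : (3 : ℝ) ≤ N := by exact_mod_cast hN
    linarith
  have hε : ∀ n : ℕ, (0 : ℝ) < 1 / ((n : ℝ) + 1) := fun n => by positivity
  have hpos : ∀ (n : ℕ) (y : Eucl N), 0 < ‖y‖ ^ 2 + 1 / ((n : ℝ) + 1) := fun n y => by positivity
  have hcont : ∀ n : ℕ, Continuous (fun y => φ y / √(‖y‖ ^ 2 + 1 / ((n : ℝ) + 1))) := fun n =>
    hφ.continuous.div (by fun_prop) fun y => (Real.sqrt_pos.2 (hpos n y)).ne'
  have hmem : ∀ n : ℕ, MemLp (fun y => φ y / √(‖y‖ ^ 2 + 1 / ((n : ℝ) + 1))) 2 (measK N) :=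
    fun n => (hcont n).memLp_of_hasCompactSupport (by
      simp only [div_eq_mul_inv]
      exact hc.mul_right)
  -- Fatou's lemma with `ε = 1 / (n + 1)` removes the regularization.
  refine (Lp.eLpNorm_lim_le_liminf_eLpNorm (fun n => (hmem n).1) _ ?_).trans ?_
  · filter_upwards [ae_ne_zero hN] with y hy
    have hy' : 0 < ‖y‖ := norm_pos_iff.2 hy
    refine Filter.Tendsto.div tendsto_const_nhds ?_ hy'.ne'
    have h1 : Filter.Tendsto (fun n : ℕ => ‖y‖ ^ 2 + 1 / ((n : ℝ) + 1)) Filter.atTop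
        (nhds (‖y‖ ^ 2 + 0)) := tendsto_const_nhds.add tendsto_one_div_add_atTop_nhds_zero_nat
    have h2 := (Real.continuous_sqrt.tendsto _).comp h1
    simpa [Real.sqrt_sq hy'.le, Function.comp_def] using h2
  · refine Filter.liminf_le_of_le (by isBoundedDefault) fun b hb => ?_
    obtain ⟨n, hn⟩ := hb.exists
    refine hn.trans (eLpNorm_two_le_of_integral_sq_le (by positivity) (hmem n)
      (memLp_gradient hφ hc 2) ?_)
    refine le_of_eq_of_le (integral_congr_ae (.of_forall fun y => ?_))
      (hardy_test_regularized hN hφ hc (hε n))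
    simp only [norm_div, div_pow, Real.norm_eq_abs, sq_abs, Real.sq_sqrt (hpos n y).le]

lemma two_lt_twoStar (hN : 3 ≤ N) : 2 < twoStar N := by
  have : (3 : ℝ) ≤ N := by exact_mod_cast hN
  rw [twoStar, lt_div_iff₀ (by linarith)]
  linarith

/-- The exponent `2*` as an extended nonnegative real. -/
abbrev sobExp (N : ℕ) : ENNReal := ENNReal.ofReal (twoStar N)

lemma toReal_sobExp (hN : 3 ≤ N) : (sobExp N).toReal = twoStar N :=
  ENNReal.toReal_ofReal (by linarith [two_lt_twoStar hN])

lemma sobExp_ne_zero (hN : 3 ≤ N) : sobExp N ≠ 0 := by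
  simp only [sobExp, ne_eq, ENNReal.ofReal_eq_zero, not_le]
  linarith [two_lt_twoStar hN]

lemma sobExp_ne_top : sobExp N ≠ ⊤ := ENNReal.ofReal_ne_top

/-- Weighted Sobolev inequality for test functions. -/
lemma sobolev_test (hN : 3 ≤ N) : ∃ C : NNReal, ∀ φ : Eucl N → ℝ, ContDiff ℝ ∞ φ →
    HasCompactSupport φ →
    eLpNorm φ (sobExp N) (measK N) ≤ C * eLpNorm (gradient φ) 2 (measK N) := by
  have hN' : (3 : ℝ) ≤ N := by exact_mod_cast hN
  have hp := two_lt_twoStar hN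
  refine ⟨SNormLESNormFDerivOfEqConst ℝ (volume : Measure (Eucl N)) 2 * Real.toNNReal 2,
    fun φ hφ hc => ?_⟩
  -- The square root of `K`. The unweighted Sobolev inequality is applied to `ψ = q φ`: since `q ≥
  -- 1` and `2* > 2`, `K = q² ≤ q^{2*}`, and `∇ψ = q (∇φ + φ y / 4)`.
  set q : Eucl N → ℝ := fun y => Real.exp (1 / 8 * ‖y‖ ^ 2) with hq
  have hq2 : ∀ y, q y ^ 2 = weight N y := fun y => by
    rw [hq, weight, ← Real.exp_nat_mul]
    congr 1
    push_cast
    ring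
  have hq1 : ∀ y, 1 ≤ q y := fun y => Real.one_le_exp (by positivity)
  have hqC : ContDiff ℝ 1 q := Real.contDiff_exp.comp (contDiff_const.mul (contDiff_norm_sq ℝ))
  have hφ1 : ContDiff ℝ 1 φ := hφ.of_le (by exact_mod_cast le_top)
  set ψ : Eucl N → ℝ := fun y => φ y * q y with hψ
  have hψC : ContDiff ℝ 1 ψ := hφ1.mul hqC
  have hψc : HasCompactSupport ψ := hc.mul_right
  have hdψ : Continuous (fderiv ℝ ψ) := hψC.continuous_fderiv (by simp)
  have hψm : MemLp (fderiv ℝ ψ) 2 (volume : Measure (Eucl N)) :=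
    hdψ.memLp_of_hasCompactSupport (hψc.fderiv ℝ)
  have hgns := eLpNorm_le_eLpNorm_fderiv_of_eq (volume : Measure (Eucl N)) hψC hψc
    (p := 2) (p' := Real.toNNReal (twoStar N)) (by norm_num) (by simp; omega) (by
      rw [Real.coe_toNNReal _ (by linarith), finrank_euclideanSpace, Fintype.card_fin, twoStar]
      push_cast
      have : (N : ℝ) - 2 ≠ 0 := by linarith
      field_simp)
  have hleft : eLpNorm φ (sobExp N) (measK N) ≤ eLpNorm ψ (sobExp N) volume := by
    rw [eLpNorm_eq_lintegral_rpow_enorm_toReal (sobExp_ne_zero hN) sobExp_ne_top,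
      eLpNorm_eq_lintegral_rpow_enorm_toReal (sobExp_ne_zero hN) sobExp_ne_top, toReal_sobExp hN,
      measK, lintegral_withDensity_eq_lintegral_mul _ (measurable_ofReal_weight N)
      (hφ.continuous.enorm.measurable.pow_const _)]
    refine ENNReal.rpow_le_rpow (lintegral_mono fun y => ?_) (by positivity)
    simp only [Pi.mul_apply, Real.enorm_eq_ofReal_abs]
    rw [ENNReal.ofReal_rpow_of_nonneg (abs_nonneg _) (by linarith),
      ENNReal.ofReal_rpow_of_nonneg (abs_nonneg _) (by linarith),
      ← ENNReal.ofReal_mul (weight_pos N y).le]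
    refine ENNReal.ofReal_le_ofReal ?_
    rw [hψ, abs_mul, Real.mul_rpow (abs_nonneg _) (abs_nonneg _), mul_comm]
    refine mul_le_mul_of_nonneg_left ?_ (by positivity)
    rw [abs_of_nonneg (by linarith [hq1 y]), ← hq2, ← Real.rpow_two]
    exact Real.rpow_le_rpow_of_exponent_le (hq1 y) hp.le
  have hright : eLpNorm (fderiv ℝ ψ) 2 (volume : Measure (Eucl N)) ≤
      ENNReal.ofReal 2 * eLpNorm (gradient φ) 2 (measK N) := by
    refine eLpNorm_two_le_of_integral_sq_le (by norm_num) hψm (memLp_gradient hφ hc 2) ?_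
    have hpt : ∀ y, ‖fderiv ℝ ψ y‖ ^ 2 ≤
        weight N y * (2 * ‖gradient φ y‖ ^ 2 + 1 / 8 * (‖y‖ ^ 2 * φ y ^ 2)) := fun y => by
      have e : HasFDerivAt ψ (φ y • (q y • (1 / 8 : ℝ) • (2 : ℝ) • innerSL ℝ y) +
          q y • fderiv ℝ φ y) y :=
        (hφ1.differentiable (by simp) y).hasFDerivAt.mul (hasFDerivAt_exp_mul_norm_sq (1 / 8) y)
      have hg : ‖gradient φ y‖ = ‖fderiv ℝ φ y‖ := by simp [gradient]
      rw [e.fderiv, hg, ← hq2]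
      have hqn : ‖q y‖ = q y := Real.norm_of_nonneg (by linarith [hq1 y])
      have hb : ‖φ y • (q y • (1 / 8 : ℝ) • (2 : ℝ) • innerSL ℝ y) + q y • fderiv ℝ φ y‖ ≤
          q y * (1 / 4 * (|φ y| * ‖y‖) + ‖fderiv ℝ φ y‖) := by
        refine (norm_add_le _ _).trans (le_of_eq ?_)
        simp only [norm_smul, innerSL_apply_norm, hqn, Real.norm_eq_abs]
        norm_num
        ring
      calc _ ≤ (q y * (1 / 4 * (|φ y| * ‖y‖) + ‖fderiv ℝ φ y‖)) ^ 2 :=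
            pow_le_pow_left₀ (norm_nonneg _) hb 2
        _ = q y ^ 2 * (1 / 4 * (|φ y| * ‖y‖) + ‖fderiv ℝ φ y‖) ^ 2 := by ring
        _ ≤ _ := by
            refine mul_le_mul_of_nonneg_left ?_ (sq_nonneg _)
            have : ‖y‖ ^ 2 * φ y ^ 2 = (|φ y| * ‖y‖) ^ 2 := by rw [mul_pow, sq_abs]; ring
            rw [this]
            nlinarith [sq_nonneg (1 / 4 * (|φ y| * ‖y‖) - ‖fderiv ℝ φ y‖)]
    have hφc := hφ.continuous
    have i1 : Integrable (fun y => ‖gradient φ y‖ ^ 2) (measK N) :=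
      (memLp_gradient hφ hc 2).norm.integrable_sq
    have i2 : Integrable (fun y => ‖y‖ ^ 2 * φ y ^ 2) (measK N) :=
      Continuous.integrable_of_hasCompactSupport (by fun_prop)
        (hc.comp_left (g := fun x : ℝ => x ^ 2) (by simp)).mul_left
    have hgc := continuous_gradient hφ
    have hwc := continuous_weight N
    calc ∫ y, ‖fderiv ℝ ψ y‖ ^ 2 ≤
        ∫ y, weight N y * (2 * ‖gradient φ y‖ ^ 2 + 1 / 8 * (‖y‖ ^ 2 * φ y ^ 2)) := by
          refine integral_mono hψm.norm.integrable_sq ?_ hpt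
          refine Continuous.integrable_of_hasCompactSupport (by fun_prop) ?_
          refine HasCompactSupport.mul_left (f := weight N) ?_
          refine HasCompactSupport.add ?_ ?_
          · exact HasCompactSupport.mul_left (f := fun _ => (2 : ℝ))
              ((hc.fderiv ℝ).comp_left (g := fun L =>
                ‖(InnerProductSpace.toDual ℝ (Eucl N)).symm L‖ ^ 2) (by simp))
          · exact (hc.comp_left (g := fun x : ℝ => x ^ 2) (by simp)).mul_left.mul_left
      _ = 2 * ∫ y, ‖gradient φ y‖ ^ 2 ∂(measK N) +
          1 / 8 * ∫ y, ‖y‖ ^ 2 * φ y ^ 2 ∂(measK N) := by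
          rw [← integral_measK, integral_add (i1.const_mul 2) (i2.const_mul _),
            integral_const_mul, integral_const_mul]
      -- The bound `∫ |y|² φ² K ≤ 16 ∫ |∇φ|² K` turns the constant into `2 + 16 / 8 = 2²`.
      _ ≤ _ := by linarith [integral_norm_sq_mul_sq_le hφ hc]
  refine hleft.trans (hgns.trans ?_)
  rw [ENNReal.coe_mul, mul_assoc]
  exact mul_le_mul_right hright _

end Test

/-! ### Inequalities on `X` -/

/-- Transfers the Hardy and Sobolev inequalities from test functions to `X`. Convergence in `L²_K`
does not control the products with `m` in `L^q`, so an almost everywhere convergent subsequence and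
Fatou's lemma are used. -/
lemma enorm_fn_mul_le {N : ℕ} {m : Eucl N → ℝ} (hm : Measurable m) {q : ENNReal} {C : NNReal}
    (h : ∀ φ : Eucl N → ℝ, ContDiff ℝ ∞ φ → HasCompactSupport φ →
      eLpNorm (fun y => φ y * m y) q (measK N) ≤ C * eLpNorm (gradient φ) 2 (measK N))
    (v : X N) : eLpNorm (fun y => fn v y * m y) q (measK N) ≤ C * ‖grad v‖ₑ := by
  obtain ⟨x, hx, hlim⟩ := mem_closure_iff_seq_limit.1 v.2
  have h1 : Filter.Tendsto (fun n => (x n).1) Filter.atTop (nhds (fn v)) :=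
    (continuous_fst.tendsto _).comp hlim
  have h2 : Filter.Tendsto (fun n => (x n).2) Filter.atTop (nhds (grad v)) :=
    (continuous_snd.tendsto _).comp hlim
  obtain ⟨ns, hns, hae⟩ := (tendstoInMeasure_of_tendsto_Lp h1).exists_seq_tendsto_ae
  have hbound : ∀ n, eLpNorm (fun y => (x n).1 y * m y) q (measK N) ≤ C * ‖(x n).2‖ₑ := fun n => by
    obtain ⟨φ, hφ, hφc, e1, e2⟩ := hx n
    rw [Lp.enorm_def, eLpNorm_congr_ae e2,
      eLpNorm_congr_ae (g := fun y => φ y * m y) (by filter_upwards [e1] with y hy; rw [hy])]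
    exact h φ hφ hφc
  have h3 : Filter.Tendsto (fun i => (C : ENNReal) * ‖(x (ns i)).2‖ₑ) Filter.atTop
      (nhds (C * ‖grad v‖ₑ)) :=
    ENNReal.Tendsto.const_mul ((h2.comp hns.tendsto_atTop).enorm) (Or.inr ENNReal.coe_ne_top)
  refine (Lp.eLpNorm_lim_le_liminf_eLpNorm
    (f := fun i y => (x (ns i)).1 y * m y) (fun i => ?_) _ ?_).trans ?_
  · exact (Lp.aestronglyMeasurable _).mul hm.aestronglyMeasurable
  · filter_upwards [hae] with y hy
    exact hy.mul_const _
  · rw [← h3.liminf_eq]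
    exact Filter.liminf_le_liminf (.of_forall fun i => hbound _)

lemma memLp_fn_mul {N : ℕ} {m : Eucl N → ℝ} (hm : Measurable m) {q : ENNReal} {C : NNReal}
    (h : ∀ v : X N, eLpNorm (fun y => fn v y * m y) q (measK N) ≤ C * ‖grad v‖ₑ) (v : X N) :
    MemLp (fun y => fn v y * m y) q (measK N) :=
  ⟨(Lp.aestronglyMeasurable _).mul hm.aestronglyMeasurable,
    (h v).trans_lt (ENNReal.mul_lt_top ENNReal.coe_lt_top enorm_lt_top)⟩

/-- Multiplication by a weight `m`, as a bounded operator from `X` to `L^q_K`. -/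
def mulLp {N : ℕ} (m : Eucl N → ℝ) (hm : Measurable m) (q : ENNReal) [Fact (1 ≤ q)] (C : NNReal)
    (h : ∀ v : X N, eLpNorm (fun y => fn v y * m y) q (measK N) ≤ C * ‖grad v‖ₑ) :
    X N →L[ℝ] Lp ℝ q (measK N) :=
  LinearMap.mkContinuous
    { toFun := fun v => (memLp_fn_mul hm h v).toLp _
      map_add' := fun u v => by
        rw [← MemLp.toLp_add, MemLp.toLp_eq_toLp_iff]
        filter_upwards [Lp.coeFn_add (fn u) (fn v)] with y hy
        have : fn (u + v) y = fn u y + fn v y := hy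
        simp [this, add_mul]
      map_smul' := fun c v => by
        rw [RingHom.id_apply, ← MemLp.toLp_const_smul, MemLp.toLp_eq_toLp_iff]
        filter_upwards [Lp.coeFn_smul c (fn v)] with y hy
        have : fn (c • v) y = c * fn v y := hy
        simp [this, mul_assoc] } C (fun v => by
    have h1 : ‖(memLp_fn_mul hm h v).toLp _‖ₑ ≤ C * ‖v‖ₑ := by
      rw [Lp.enorm_toLp]
      refine (h v).trans (mul_le_mul_right ?_ _)
      rw [enorm_le_iff_norm_le]
      exact le_max_right _ _
    have h2 := ENNReal.toReal_mono (by finiteness) h1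
    simpa using h2)

lemma coeFn_mulLp {N : ℕ} (m : Eucl N → ℝ) (hm : Measurable m) (q : ENNReal) [Fact (1 ≤ q)]
    (C : NNReal) (h : ∀ v : X N, eLpNorm (fun y => fn v y * m y) q (measK N) ≤ C * ‖grad v‖ₑ)
    (v : X N) : mulLp m hm q C h v =ᵐ[measK N] fun y => fn v y * m y :=
  MemLp.coeFn_toLp (memLp_fn_mul hm h v)

lemma norm_mulLp_le {N : ℕ} (m : Eucl N → ℝ) (hm : Measurable m) (q : ENNReal) [Fact (1 ≤ q)]
    (C : NNReal) (h : ∀ v : X N, eLpNorm (fun y => fn v y * m y) q (measK N) ≤ C * ‖grad v‖ₑ)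
    (v : X N) : ‖mulLp m hm q C h v‖ ≤ C * ‖grad v‖ := by
  have h1 : ‖mulLp m hm q C h v‖ₑ ≤ C * ‖grad v‖ₑ := by
    rw [Lp.enorm_def, eLpNorm_congr_ae (coeFn_mulLp m hm q C h v)]
    exact h v
  have h2 := ENNReal.toReal_mono (by finiteness) h1
  simpa using h2

/-- The function underlying an element of `X`, as a bounded operator. -/
def fnL (N : ℕ) : X N →L[ℝ] L2K N := (ContinuousLinearMap.fst ℝ _ _).comp (X N).subtypeL

/-- The gradient on `X`, as a bounded operator. -/
def gradL (N : ℕ) : X N →L[ℝ] L2KVec N := (ContinuousLinearMap.snd ℝ _ _).comp (X N).subtypeL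

lemma fnL_apply {N : ℕ} (v : X N) : fnL N v = fn v := rfl

lemma gradL_apply {N : ℕ} (v : X N) : gradL N v = grad v := rfl

lemma norm_sq_eq_integral {α E : Type*} [MeasurableSpace α] {μ : Measure α}
    [NormedAddCommGroup E] [InnerProductSpace ℝ E] (f : Lp E 2 μ) :
    ‖f‖ ^ 2 = ∫ x, ‖f x‖ ^ 2 ∂μ := by
  rw [← real_inner_self_eq_norm_sq, L2.inner_def]
  simp only [real_inner_self_eq_norm_sq]

lemma norm_rpow_eq_integral {α : Type*} [MeasurableSpace α] {ν : Measure α} {p : ℝ}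
    (hp : 2 < p) (v : Lp ℝ (ENNReal.ofReal p) ν) :
    ‖v‖ ^ p = ∫ x, |v x| ^ p ∂ν := by
  have h := (Lp.memLp v).eLpNorm_eq_integral_rpow_norm (by simp; linarith) ENNReal.ofReal_ne_top
  rw [ENNReal.toReal_ofReal (by linarith)] at h
  have h0 : 0 ≤ ∫ x, ‖v x‖ ^ p ∂ν :=
    integral_nonneg fun y => Real.rpow_nonneg (norm_nonneg _) _
  rw [Lp.norm_def, h, ENNReal.toReal_ofReal (Real.rpow_nonneg h0 _),
    Real.rpow_inv_rpow h0 (by linarith)]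
  simp only [Real.norm_eq_abs]

/-- Poincaré inequality on `X`. -/
lemma poincare {N : ℕ} (v : X N) : (N : ℝ) / 2 * ‖fn v‖ ^ 2 ≤ ‖grad v‖ ^ 2 := by
  have hcl : IsClosed {p : L2K N × L2KVec N | (N : ℝ) / 2 * ‖p.1‖ ^ 2 ≤ ‖p.2‖ ^ 2} :=
    isClosed_le (by fun_prop) (by fun_prop)
  refine closure_minimal (s := (testGraph N : Set (L2K N × L2KVec N))) ?_ hcl v.2
  rintro p ⟨φ, hφ, hφc, e1, e2⟩
  have h1 : ‖p.1‖ ^ 2 = ∫ y, φ y ^ 2 ∂(measK N) := by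
    rw [norm_sq_eq_integral]
    refine integral_congr_ae ?_
    filter_upwards [e1] with y hy
    simp [hy]
  have h2 : ‖p.2‖ ^ 2 = ∫ y, ‖gradient φ y‖ ^ 2 ∂(measK N) := by
    rw [norm_sq_eq_integral]
    refine integral_congr_ae ?_
    filter_upwards [e2] with y hy
    rw [hy]
  change (N : ℝ) / 2 * ‖p.1‖ ^ 2 ≤ ‖p.2‖ ^ 2
  rw [h1, h2]
  exact poincare_test hφ hφc

lemma measurable_norm_inv {N : ℕ} : Measurable (fun y : Eucl N => ‖y‖⁻¹) := measurable_norm.inv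

section Ge3

variable {N : ℕ} [hN : Fact (3 ≤ N)]

lemma three_le_cast : (3 : ℝ) ≤ N := by exact_mod_cast hN.out

instance : Fact (1 ≤ sobExp N) := ⟨by
  rw [sobExp, ← ENNReal.ofReal_one]
  exact ENNReal.ofReal_le_ofReal (by linarith [two_lt_twoStar hN.out])⟩

lemma norm_fn_le (v : X N) : ‖fn v‖ ≤ ‖grad v‖ := by
  have h := poincare v
  have h3 : (3 : ℝ) ≤ N := three_le_cast
  refine abs_le_of_sq_le_sq' ?_ (norm_nonneg _) |>.2
  nlinarith [sq_nonneg ‖fn v‖]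

/-- The subspace `X` carries the maximum norm of the product; by Poincaré with `N / 2 ≥ 1` the
gradient component always attains it. -/
lemma norm_eq_norm_grad (v : X N) : ‖v‖ = ‖grad v‖ := by
  have : ‖v‖ = max ‖fn v‖ ‖grad v‖ := rfl
  rw [this, max_eq_right (norm_fn_le v)]

lemma enorm_fn_mul_norm_inv_le (v : X N) : eLpNorm (fun y => fn v y * ‖y‖⁻¹) 2 (measK N) ≤
    Real.toNNReal (2 / ((N : ℝ) - 2)) * ‖grad v‖ₑ :=
  enorm_fn_mul_le measurable_norm_inv (fun _ hφ hc => hardy_test hN.out hφ hc) v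

/-- The operator `v ↦ v / |y|`. -/
def hardyL : X N →L[ℝ] L2K N :=
  mulLp (fun y => ‖y‖⁻¹) measurable_norm_inv 2 (Real.toNNReal (2 / ((N : ℝ) - 2)))
    enorm_fn_mul_norm_inv_le

lemma coeFn_hardyL (v : X N) : hardyL v =ᵐ[measK N] fun y => fn v y / ‖y‖ := by
  simp only [div_eq_mul_inv]
  exact coeFn_mulLp _ _ _ _ _ v

/-- Hardy inequality on `X`. -/
lemma norm_hardyL_le (v : X N) : ‖hardyL v‖ ≤ 2 / ((N : ℝ) - 2) * ‖grad v‖ := by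
  have h3 : (3 : ℝ) ≤ N := three_le_cast
  have h := norm_mulLp_le _ measurable_norm_inv 2 _ enorm_fn_mul_norm_inv_le v
  rwa [Real.coe_toNNReal _ (div_nonneg (by norm_num) (by linarith))] at h

lemma sobolev_aux : ∃ C : NNReal, ∀ φ : Eucl N → ℝ, ContDiff ℝ ∞ φ → HasCompactSupport φ →
    eLpNorm (fun y => φ y * 1) (sobExp N) (measK N) ≤ C * eLpNorm (gradient φ) 2 (measK N) := by
  simpa using sobolev_test hN.out

/-- A constant in the weighted Sobolev inequality. -/
def sobConst (N : ℕ) [Fact (3 ≤ N)] : NNReal := (sobolev_aux (N := N)).choose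

/-- The Sobolev embedding of `X` into `L^{2*}_K`. -/
def sobL : X N →L[ℝ] Lp ℝ (sobExp N) (measK N) :=
  mulLp (fun _ => 1) measurable_const (sobExp N) (sobConst N)
    (enorm_fn_mul_le measurable_const (sobolev_aux (N := N)).choose_spec)

lemma coeFn_sobL (v : X N) : sobL v =ᵐ[measK N] fn v := by
  have := coeFn_mulLp (fun _ => 1) measurable_const (sobExp N) (sobConst N)
    (enorm_fn_mul_le measurable_const (sobolev_aux (N := N)).choose_spec) v
  simp only [mul_one] at this
  exact this

/-- Weighted Sobolev inequality on `X`. -/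
lemma norm_sobL_le (v : X N) : ‖sobL v‖ ≤ sobConst N * ‖grad v‖ :=
  norm_mulLp_le _ _ _ _ _ v

lemma quadA_eq (μ : ℝ) (v : X N) :
    quadA N μ v = ‖grad v‖ ^ 2 - μ * ‖hardyL v‖ ^ 2 - beta N * ‖fn v‖ ^ 2 := by
  have i1 : Integrable (fun y => ‖grad v y‖ ^ 2) (measK N) := (Lp.memLp (grad v)).norm.integrable_sq
  have i2 : Integrable (fun y => ‖hardyL v y‖ ^ 2) (measK N) :=
    (Lp.memLp (hardyL v)).norm.integrable_sq
  have i3 : Integrable (fun y => ‖fn v y‖ ^ 2) (measK N) := (Lp.memLp (fn v)).norm.integrable_sq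
  have i12 : Integrable (fun y => ‖grad v y‖ ^ 2 - μ * ‖hardyL v y‖ ^ 2) (measK N) :=
    i1.sub (i2.const_mul μ)
  rw [norm_sq_eq_integral, norm_sq_eq_integral, norm_sq_eq_integral, ← integral_const_mul,
    ← integral_const_mul, ← integral_sub i1 (i2.const_mul μ), ← integral_sub i12 (i3.const_mul _)]
  refine integral_congr_ae ?_
  filter_upwards [coeFn_hardyL v] with y hy
  simp [hy, div_pow]

lemma funB_eq (v : X N) : funB N v = ‖sobL v‖ ^ twoStar N := by
  rw [norm_rpow_eq_integral (two_lt_twoStar hN.out)]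
  refine integral_congr_ae ?_
  filter_upwards [coeFn_sobL v] with y hy
  rw [hy]

lemma funB_nonneg (v : X N) : 0 ≤ funB N v := by
  rw [funB_eq]
  positivity

lemma continuous_quadA (μ : ℝ) : Continuous (quadA N μ) := by
  have : quadA N μ = fun v => ‖gradL N v‖ ^ 2 - μ * ‖hardyL v‖ ^ 2 - beta N * ‖fnL N v‖ ^ 2 :=
    funext fun v => quadA_eq μ v
  rw [this]
  fun_prop

lemma continuous_funB : Continuous (funB N) := by
  have : funB N = fun v => ‖sobL v‖ ^ twoStar N := funext fun v => funB_eq v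
  rw [this]
  exact (sobL.continuous.norm).rpow_const fun v => Or.inr (by linarith [two_lt_twoStar hN.out])

lemma continuous_energy (μ : ℝ) : Continuous (energy N μ) :=
  ((continuous_quadA μ).const_mul _).sub (continuous_funB.const_mul _)

lemma continuous_nehari (μ : ℝ) : Continuous (nehari N μ) :=
  (continuous_quadA μ).sub continuous_funB

lemma quadA_smul (μ c : ℝ) (v : X N) : quadA N μ (c • v) = c ^ 2 * quadA N μ v := by
  rw [quadA_eq, quadA_eq, ← gradL_apply, ← fnL_apply]
  simp only [map_smul, norm_smul, mul_pow, Real.norm_eq_abs, sq_abs, gradL_apply, fnL_apply]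
  ring

lemma funB_smul {c : ℝ} (hc : 0 ≤ c) (v : X N) :
    funB N (c • v) = c ^ twoStar N * funB N v := by
  rw [funB_eq, funB_eq, map_smul, norm_smul, Real.mul_rpow (norm_nonneg _) (norm_nonneg _),
    Real.norm_of_nonneg hc]

/-- Coercivity of `A`. -/
lemma norm_grad_sq_le_quadA {μ : ℝ} (hμ₁ : μ ≤ ((N : ℝ) - 2) ^ 2 / 8) (v : X N) :
    1 / (N : ℝ) * ‖grad v‖ ^ 2 ≤ quadA N μ v := by
  have h3 : (3 : ℝ) ≤ N := three_le_cast
  have hh : ‖hardyL v‖ ^ 2 ≤ (2 / ((N : ℝ) - 2) * ‖grad v‖) ^ 2 :=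
    pow_le_pow_left₀ (norm_nonneg _) (norm_hardyL_le v) 2
  have h1 : μ * ‖hardyL v‖ ^ 2 ≤ 1 / 2 * ‖grad v‖ ^ 2 := by
    calc μ * ‖hardyL v‖ ^ 2 ≤ ((N : ℝ) - 2) ^ 2 / 8 * ‖hardyL v‖ ^ 2 :=
          mul_le_mul_of_nonneg_right hμ₁ (sq_nonneg _)
      _ ≤ ((N : ℝ) - 2) ^ 2 / 8 * (2 / ((N : ℝ) - 2) * ‖grad v‖) ^ 2 :=
          mul_le_mul_of_nonneg_left hh (by positivity)
      _ = 1 / 2 * ‖grad v‖ ^ 2 := by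
          have : (N : ℝ) - 2 ≠ 0 := by linarith
          field_simp
          ring
  have h2 : beta N * ‖fn v‖ ^ 2 ≤ ((N : ℝ) - 2) / (2 * N) * ‖grad v‖ ^ 2 := by
    calc beta N * ‖fn v‖ ^ 2 = ((N : ℝ) - 2) / (2 * N) * (N / 2 * ‖fn v‖ ^ 2) := by
          rw [beta]; field_simp; ring
      _ ≤ _ := mul_le_mul_of_nonneg_left (poincare v)
          (div_nonneg (by linarith) (by linarith))
  -- Hardy costs at most `1/2` of `‖∇v‖²` and Poincaré `(N - 2) / (2N)`, which leaves `1 / N`.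
  have h4 : 1 / (N : ℝ) * ‖grad v‖ ^ 2 = ‖grad v‖ ^ 2 - 1 / 2 * ‖grad v‖ ^ 2 -
      ((N : ℝ) - 2) / (2 * N) * ‖grad v‖ ^ 2 := by
    field_simp; ring
  rw [quadA_eq, h4]
  linarith

lemma norm_fn_sq_le_quadA {μ : ℝ} (hμ₁ : μ ≤ ((N : ℝ) - 2) ^ 2 / 8) (v : X N) :
    1 / 2 * ‖fn v‖ ^ 2 ≤ quadA N μ v := by
  have h3 : (3 : ℝ) ≤ N := three_le_cast
  refine le_trans ?_ (norm_grad_sq_le_quadA hμ₁ v)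
  calc 1 / 2 * ‖fn v‖ ^ 2 = 1 / (N : ℝ) * (N / 2 * ‖fn v‖ ^ 2) := by field_simp
    _ ≤ _ := mul_le_mul_of_nonneg_left (poincare v) (by positivity)

lemma quadA_pos {μ : ℝ} (hμ₁ : μ ≤ ((N : ℝ) - 2) ^ 2 / 8) {v : X N} (hv : ‖grad v‖ ≠ 0) :
    0 < quadA N μ v := by
  have h3 : (3 : ℝ) ≤ N := three_le_cast
  refine lt_of_lt_of_le ?_ (norm_grad_sq_le_quadA hμ₁ v)
  have : 0 < ‖grad v‖ := lt_of_le_of_ne (norm_nonneg _) hv.symm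
  positivity

end Ge3

/-! ### The power nonlinearity -/

/-- A convex power lies above its tangent at `x`; this is Bernoulli's inequality for the ratio `y /
x`. -/
lemma rpow_add_mul_sub_le_rpow {x y r : ℝ} (hx : 0 ≤ x) (hy : 0 ≤ y) (hr : 1 < r) :
    x ^ r + r * x ^ (r - 1) * (y - x) ≤ y ^ r := by
  rcases hx.eq_or_lt with rfl | hx
  · rw [Real.zero_rpow (by linarith), Real.zero_rpow (by linarith)]
    simpa using Real.rpow_nonneg hy r
  · have h := one_add_mul_self_le_rpow_one_add (s := y / x - 1) (p := r)
      (by linarith [div_nonneg hy hx.le]) hr.le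
    rw [add_sub_cancel, Real.div_rpow hy hx.le, le_div_iff₀ (by positivity)] at h
    rw [Real.rpow_sub_one hx.ne']
    refine le_trans (le_of_eq ?_) h
    field_simp

/-- A mean value estimate for `t ↦ |t|^q t`. The bound involves `|a|` and `|a - b|` but not `|b|`,
so that later the potential comes from a fixed function while the other varies. -/
lemma abs_rpow_mul_sub_le {q : ℝ} (hq : 0 < q) (a b : ℝ) :
    |(|a| ^ q * a - |b| ^ q * b)| ≤
      (q + 1) * 2 ^ q * (|a| ^ q + |a - b| ^ q) * |a - b| := by
  -- The tangent inequality at `|x|` gives `(|x|^q - |y|^q) |y| ≤ q |x|^q (|x| - |y|)`, which avoids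
  -- dividing by `|y|` or differentiating `t^q` when `q < 1`.
  have aux : ∀ x y : ℝ, |y| ≤ |x| → |(|x| ^ q * x - |y| ^ q * y)| ≤ (q + 1) * |x| ^ q * |x - y| := by
    intro x y hxy
    have h := rpow_add_mul_sub_le_rpow (abs_nonneg x) (abs_nonneg y) (r := q + 1) (by linarith)
    rw [add_sub_cancel_right, Real.rpow_add_one' (abs_nonneg _) (by linarith),
      Real.rpow_add_one' (abs_nonneg _) (by linarith)] at h
    have hle : |y| ^ q ≤ |x| ^ q := Real.rpow_le_rpow (abs_nonneg _) hxy hq.le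
    have htri : |x| - |y| ≤ |x - y| := abs_sub_abs_le_abs_sub x y
    have hx0 : 0 ≤ |x| ^ q := by positivity
    calc |(|x| ^ q * x - |y| ^ q * y)| = |(|x| ^ q * (x - y) + (|x| ^ q - |y| ^ q) * y)| := by ring_nf
      _ ≤ |(|x| ^ q * (x - y))| + |((|x| ^ q - |y| ^ q) * y)| := abs_add_le _ _
      _ = |x| ^ q * |x - y| + (|x| ^ q - |y| ^ q) * |y| := by
          rw [abs_mul, abs_mul, abs_of_nonneg hx0, abs_of_nonneg (sub_nonneg.2 hle)]
      _ ≤ |x| ^ q * |x - y| + q * |x| ^ q * (|x| - |y|) := by nlinarith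
      _ ≤ |x| ^ q * |x - y| + q * |x| ^ q * |x - y| := by gcongr
      _ = _ := by ring
  have hmax : ∀ m : ℝ, 0 ≤ m → m ≤ |a| + |a - b| → m ^ q ≤ 2 ^ q * (|a| ^ q + |a - b| ^ q) := by
    intro m hm0 hm
    have h1 : m ≤ 2 * max |a| |a - b| := by
      linarith [le_max_left |a| |a - b|, le_max_right |a| |a - b|]
    calc m ^ q ≤ (2 * max |a| |a - b|) ^ q := Real.rpow_le_rpow hm0 h1 hq.le
      _ = 2 ^ q * max |a| |a - b| ^ q := Real.mul_rpow (by norm_num) (by positivity)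
      _ ≤ _ := by
        refine mul_le_mul_of_nonneg_left ?_ (by positivity)
        have ha : 0 ≤ |a| ^ q := by positivity
        have hb : 0 ≤ |a - b| ^ q := by positivity
        rcases max_choice |a| |a - b| with h | h <;> rw [h] <;> linarith
  have key : ∃ m : ℝ, 0 ≤ m ∧ m ≤ |a| + |a - b| ∧
      |(|a| ^ q * a - |b| ^ q * b)| ≤ (q + 1) * m ^ q * |a - b| := by
    rcases le_total |b| |a| with h | h
    · exact ⟨|a|, abs_nonneg _, by linarith [abs_nonneg (a - b)], aux a b h⟩
    · refine ⟨|b|, abs_nonneg _, ?_, ?_⟩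
      · have := abs_sub_abs_le_abs_sub b a
        rw [abs_sub_comm b a] at this
        linarith
      · have := aux b a h
        rwa [abs_sub_comm, abs_sub_comm b a] at this
  obtain ⟨m, hm0, hm1, hm2⟩ := key
  calc _ ≤ (q + 1) * m ^ q * |a - b| := hm2
    _ ≤ (q + 1) * (2 ^ q * (|a| ^ q + |a - b| ^ q)) * |a - b| := by
        gcongr
        exact hmax m hm0 hm1
    _ = _ := by ring

/-- With `F(t) = |t|^{q+2} / (q+2)`, convexity gives `F(z) - F(u) ≤ F'(z) (z - u)`, so the remainder
at `u` is at most `(F'(z) - F'(u)) (z - u)`. -/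
lemma rpow_abs_sub_sub_le {q : ℝ} (hq : 0 < q) (z u : ℝ) :
    1 / (q + 2) * |z| ^ (q + 2) - 1 / (q + 2) * |u| ^ (q + 2) - |u| ^ q * u * (z - u) ≤
      (q + 1) * 2 ^ q * (|z| ^ q * |z - u| * |z - u| + |z - u| ^ q * |z - u| * |z - u|) := by
  have h1 := abs_rpow_mul_sub_le hq z u
  have h2 := rpow_add_mul_sub_le_rpow (abs_nonneg z) (abs_nonneg u) (r := q + 2) (by linarith)
  have h3 : |z| ^ (q + 2 - 1) = |z| ^ q * |z| := by
    rw [← Real.rpow_add_one' (abs_nonneg _) (by linarith)]; congr 1; ring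
  rw [h3] at h2
  have h5 : 1 / (q + 2) * |z| ^ (q + 2) - 1 / (q + 2) * |u| ^ (q + 2) ≤ |z| ^ q * z * (z - u) := by
    have h6 : 1 / (q + 2) * |z| ^ (q + 2) + |z| ^ q * |z| * (|u| - |z|) ≤
        1 / (q + 2) * |u| ^ (q + 2) := by
      have := mul_le_mul_of_nonneg_left h2 (a := 1 / (q + 2)) (by positivity)
      refine le_trans (le_of_eq ?_) this
      field_simp
    have h7 : |z| ^ q * (z * u) ≤ |z| ^ q * (|z| * |u|) :=
      mul_le_mul_of_nonneg_left ((le_abs_self _).trans (abs_mul z u).le) (by positivity)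
    have h9 : |z| ^ q * (|z| * |z|) = |z| ^ q * (z * z) := by rw [abs_mul_abs_self]
    linarith
  have h8 : (|z| ^ q * z - |u| ^ q * u) * (z - u) ≤
      (q + 1) * 2 ^ q * (|z| ^ q + |z - u| ^ q) * |z - u| * |z - u| := by
    refine (le_abs_self _).trans ?_
    rw [abs_mul]
    exact mul_le_mul_of_nonneg_right h1 (abs_nonneg _)
  nlinarith

/-! ### Hölder estimates and the derivative of the power functional on `L^p` -/

section Lp

variable {α : Type*} [MeasurableSpace α] {ν : Measure α} {q : ℝ}

/-- Hölder inequality `∫ |a|^q |b| |c| ≤ ‖a‖^q ‖b‖ ‖c‖` in `L^{q+2}`. -/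
lemma lintegral_rpow_mul_mul_le (hq : 0 < q) {a b c : α → ℝ} (ha : AEStronglyMeasurable a ν)
    (hb : AEStronglyMeasurable b ν) (hc : AEStronglyMeasurable c ν) :
    ∫⁻ x, ‖|a x| ^ q * |b x| * |c x|‖ₑ ∂ν ≤
      eLpNorm a (ENNReal.ofReal (q + 2)) ν ^ q * eLpNorm b (ENNReal.ofReal (q + 2)) ν *
        eLpNorm c (ENNReal.ofReal (q + 2)) ν := by
  have hp : 0 < q + 2 := by linarith
  have hp0 : ENNReal.ofReal (q + 2) ≠ 0 := by simpa using hp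
  have key := ENNReal.lintegral_prod_norm_pow_le (μ := ν) Finset.univ
    (f := ![fun x => ‖a x‖ₑ ^ (q + 2), fun x => ‖b x‖ₑ ^ (q + 2), fun x => ‖c x‖ₑ ^ (q + 2)])
    (p := ![q / (q + 2), 1 / (q + 2), 1 / (q + 2)]) (by
      intro i _
      fin_cases i
      · exact ha.enorm.pow_const _
      · exact hb.enorm.pow_const _
      · exact hc.enorm.pow_const _) (by
      simp [Fin.sum_univ_three]; field_simp; ring) (by
      intro i _
      fin_cases i <;> simp <;> positivity)
  simp only [Fin.prod_univ_three, Matrix.cons_val_zero, Matrix.cons_val_one, Matrix.cons_val,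
    ← ENNReal.rpow_mul] at key
  simp only [eLpNorm_eq_lintegral_rpow_enorm_toReal hp0 ENNReal.ofReal_ne_top,
    ENNReal.toReal_ofReal hp.le, ← ENNReal.rpow_mul]
  have e1 : (q + 2) * (q / (q + 2)) = q := by field_simp
  have e2 : (q + 2) * (1 / (q + 2)) = 1 := by field_simp
  have e3 : 1 / (q + 2) * q = q / (q + 2) := by ring
  simp only [e1, e2, ENNReal.rpow_one] at key
  rw [e3]
  refine le_trans (le_of_eq (lintegral_congr fun x => ?_)) key
  rw [enorm_mul, enorm_mul, Real.enorm_rpow_of_nonneg (abs_nonneg _) hq.le]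
  simp

variable {p : ℝ}

lemma integrable_rpow_mul_mul (hp : 2 < p) {a b c : α → ℝ} (ha : MemLp a (ENNReal.ofReal p) ν)
    (hb : MemLp b (ENNReal.ofReal p) ν) (hc : MemLp c (ENNReal.ofReal p) ν) :
    Integrable (fun x => |a x| ^ (p - 2) * |b x| * |c x|) ν := by
  have h := lintegral_rpow_mul_mul_le (q := p - 2) (by linarith) ha.1 hb.1 hc.1
  rw [sub_add_cancel] at h
  refine ⟨?_, h.trans_lt ?_⟩
  · exact ((ha.1.norm.aemeasurable.pow_const _).aestronglyMeasurable.mul hb.1.norm).mul hc.1.norm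
  · exact ENNReal.mul_lt_top (ENNReal.mul_lt_top
      (ENNReal.rpow_lt_top_of_nonneg (by linarith) ha.2.ne) hb.2) hc.2

lemma integral_rpow_mul_mul_le (hp : 2 < p) {a b c : α → ℝ} (ha : MemLp a (ENNReal.ofReal p) ν)
    (hb : MemLp b (ENNReal.ofReal p) ν) (hc : MemLp c (ENNReal.ofReal p) ν) :
    ∫ x, |a x| ^ (p - 2) * |b x| * |c x| ∂ν ≤
      (eLpNorm a (ENNReal.ofReal p) ν).toReal ^ (p - 2) * (eLpNorm b (ENNReal.ofReal p) ν).toReal *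
        (eLpNorm c (ENNReal.ofReal p) ν).toReal := by
  have h := lintegral_rpow_mul_mul_le (q := p - 2) (by linarith) ha.1 hb.1 hc.1
  rw [sub_add_cancel] at h
  have h0 : ∀ x, 0 ≤ |a x| ^ (p - 2) * |b x| * |c x| := fun x => by positivity
  have hfin := ENNReal.mul_ne_top (ENNReal.mul_ne_top
      (ENNReal.rpow_ne_top_of_nonneg (x := eLpNorm a (ENNReal.ofReal p) ν) (y := p - 2)
        (by linarith) ha.2.ne) hb.2.ne) hc.2.ne
  have h2 := ENNReal.toReal_mono hfin h
  rw [ENNReal.toReal_mul, ENNReal.toReal_mul, ← ENNReal.toReal_rpow] at h2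
  rwa [← integral_norm_eq_lintegral_enorm (integrable_rpow_mul_mul hp ha hb hc).1,
    integral_congr_ae (.of_forall fun x => Real.norm_of_nonneg (h0 x))] at h2

lemma integrable_abs_rpow_mul_self_mul (hp : 2 < p) {a b c : α → ℝ}
    (ha : MemLp a (ENNReal.ofReal p) ν) (hb : MemLp b (ENNReal.ofReal p) ν)
    (hc : MemLp c (ENNReal.ofReal p) ν) :
    Integrable (fun x => |a x| ^ (p - 2) * b x * c x) ν := by
  refine (integrable_rpow_mul_mul hp ha hb hc).mono ?_ (.of_forall fun x => ?_)
  · exact ((ha.1.norm.aemeasurable.pow_const _).aestronglyMeasurable.mul hb.1).mul hc.1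
  · simp

lemma integrable_abs_rpow (hp : 2 < p) (v : Lp ℝ (ENNReal.ofReal p) ν) :
    Integrable (fun x => |v x| ^ p) ν := by
  have := (Lp.memLp v).integrable_norm_rpow (by simp; linarith) ENNReal.ofReal_ne_top
  rwa [ENNReal.toReal_ofReal (by linarith)] at this

variable [Fact (1 ≤ ENNReal.ofReal p)]

/-- The functional `w ↦ ∫ |v|^{p-2} v w` on `L^p`. -/
def powDual (hp : 2 < p) (v : Lp ℝ (ENNReal.ofReal p) ν) : Lp ℝ (ENNReal.ofReal p) ν →L[ℝ] ℝ :=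
  LinearMap.mkContinuous
    { toFun := fun w => ∫ x, |v x| ^ (p - 2) * v x * w x ∂ν
      map_add' := fun w₁ w₂ => by
        have hv := Lp.memLp v
        rw [← integral_add (integrable_abs_rpow_mul_self_mul hp hv hv (Lp.memLp w₁))
          (integrable_abs_rpow_mul_self_mul hp hv hv (Lp.memLp w₂))]
        refine integral_congr_ae ?_
        filter_upwards [Lp.coeFn_add w₁ w₂] with x hx
        rw [hx, Pi.add_apply, mul_add]
      map_smul' := fun c w => by
        rw [RingHom.id_apply, smul_eq_mul, ← integral_const_mul]
        refine integral_congr_ae ?_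
        filter_upwards [Lp.coeFn_smul c w] with x hx
        rw [hx, Pi.smul_apply, smul_eq_mul]
        ring } (‖v‖ ^ (p - 2) * ‖v‖) (fun w => by
    have hv := Lp.memLp v
    have hw := Lp.memLp w
    refine (norm_integral_le_integral_norm _).trans (le_trans (le_of_eq ?_)
      (integral_rpow_mul_mul_le hp hv hv hw))
    refine integral_congr_ae (.of_forall fun x => ?_)
    simp only [norm_mul, Real.norm_eq_abs, abs_of_nonneg (Real.rpow_nonneg (abs_nonneg (v x)) _)])

lemma powDual_apply (hp : 2 < p) (v w : Lp ℝ (ENNReal.ofReal p) ν) :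
    powDual hp v w = ∫ x, |v x| ^ (p - 2) * v x * w x ∂ν := rfl

lemma norm_powDual_sub_le (hp : 2 < p) (v u : Lp ℝ (ENNReal.ofReal p) ν) :
    ‖powDual hp v - powDual hp u‖ ≤
      (p - 1) * 2 ^ (p - 2) * (‖v‖ ^ (p - 2) + ‖v - u‖ ^ (p - 2)) * ‖v - u‖ := by
  have hC : 0 ≤ (p - 1) * (2 : ℝ) ^ (p - 2) := mul_nonneg (by linarith) (by positivity)
  refine ContinuousLinearMap.opNorm_le_bound _ (by positivity) fun w => ?_
  have hv := Lp.memLp v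
  have hu := Lp.memLp u
  have hw := Lp.memLp w
  have hd := Lp.memLp (v - u)
  rw [sub_apply, powDual_apply, powDual_apply,
    ← integral_sub (integrable_abs_rpow_mul_self_mul hp hv hv hw)
      (integrable_abs_rpow_mul_self_mul hp hu hu hw)]
  have i1 := integrable_rpow_mul_mul hp hv hd hw
  have i2 := integrable_rpow_mul_mul hp hd hd hw
  calc _ ≤ ∫ x, (p - 1) * 2 ^ (p - 2) * (|v x| ^ (p - 2) * |(v - u) x| * |w x| +
        |(v - u) x| ^ (p - 2) * |(v - u) x| * |w x|) ∂ν := by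
        refine norm_integral_le_of_norm_le ((i1.add i2).const_mul _) ?_
        filter_upwards [Lp.coeFn_sub v u] with x hx
        rw [← sub_mul, norm_mul, hx, Pi.sub_apply, Real.norm_eq_abs, Real.norm_eq_abs]
        have h := mul_le_mul_of_nonneg_right
          (abs_rpow_mul_sub_le (q := p - 2) (by linarith) (v x) (u x)) (abs_nonneg (w x))
        refine h.trans (le_of_eq ?_)
        ring
    _ ≤ (p - 1) * 2 ^ (p - 2) * (‖v‖ ^ (p - 2) * ‖v - u‖ * ‖w‖ +
        ‖v - u‖ ^ (p - 2) * ‖v - u‖ * ‖w‖) := by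
        rw [integral_const_mul, integral_add i1 i2]
        exact mul_le_mul_of_nonneg_left (add_le_add (integral_rpow_mul_mul_le hp hv hd hw)
          (integral_rpow_mul_mul_le hp hd hd hw)) hC
    _ = _ := by ring

lemma continuous_powDual (hp : 2 < p) :
    Continuous (powDual hp : Lp ℝ (ENNReal.ofReal p) ν → _) := by
  rw [continuous_iff_continuousAt]
  intro v
  rw [ContinuousAt, tendsto_iff_norm_sub_tendsto_zero]
  have hc : Continuous (fun u : Lp ℝ (ENNReal.ofReal p) ν =>
      (p - 1) * 2 ^ (p - 2) * (‖v‖ ^ (p - 2) + ‖v - u‖ ^ (p - 2)) * ‖v - u‖) := by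
    have : Continuous (fun u : Lp ℝ (ENNReal.ofReal p) ν => ‖v - u‖ ^ (p - 2)) :=
      (by fun_prop : Continuous fun u : Lp ℝ (ENNReal.ofReal p) ν => ‖v - u‖).rpow_const
        fun _ => Or.inr (by linarith)
    fun_prop
  refine squeeze_zero (fun _ => norm_nonneg _) (fun u => ?_)
    (by simpa using hc.tendsto v)
  rw [norm_sub_rev]
  exact norm_powDual_sub_le hp v u

/-- Second order remainder of `v ↦ ‖v‖^p / p` on `L^p`. -/
lemma norm_rpow_remainder_le (hp : 2 < p) (z u : Lp ℝ (ENNReal.ofReal p) ν) :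
    1 / p * ‖z‖ ^ p - 1 / p * ‖u‖ ^ p - powDual hp u (z - u) ≤ (p - 1) * 2 ^ (p - 2) *
      (∫ x, |z x| ^ (p - 2) * |(z - u) x| * |(z - u) x| ∂ν + ‖z - u‖ ^ (p - 2) * ‖z - u‖ ^ 2) := by
  have hz := Lp.memLp z
  have hu := Lp.memLp u
  have hd := Lp.memLp (z - u)
  have i1 := (integrable_abs_rpow hp z).const_mul (1 / p)
  have i2 := (integrable_abs_rpow hp u).const_mul (1 / p)
  have i3 := integrable_abs_rpow_mul_self_mul hp hu hu hd
  have i4 := integrable_rpow_mul_mul hp hz hd hd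
  have i5 := integrable_rpow_mul_mul hp hd hd hd
  have i12 : Integrable (fun x => 1 / p * |z x| ^ p - 1 / p * |u x| ^ p) ν := i1.sub i2
  have h5 : ∫ x, |(z - u) x| ^ (p - 2) * |(z - u) x| * |(z - u) x| ∂ν ≤
      ‖z - u‖ ^ (p - 2) * ‖z - u‖ ^ 2 :=
    (integral_rpow_mul_mul_le hp hd hd hd).trans_eq (by rw [Lp.norm_def]; ring)
  rw [norm_rpow_eq_integral hp, norm_rpow_eq_integral hp, powDual_apply, ← integral_const_mul,
    ← integral_const_mul, ← integral_sub i1 i2, ← integral_sub i12 i3]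
  calc _ ≤ ∫ x, (p - 1) * 2 ^ (p - 2) * (|z x| ^ (p - 2) * |(z - u) x| * |(z - u) x| +
        |(z - u) x| ^ (p - 2) * |(z - u) x| * |(z - u) x|) ∂ν := by
        refine integral_mono_ae (i12.sub i3) ((i4.add i5).const_mul _) ?_
        filter_upwards [Lp.coeFn_sub z u] with x hx
        have h := rpow_abs_sub_sub_le (q := p - 2) (by linarith) (z x) (u x)
        rw [sub_add_cancel] at h
        simp only [Pi.sub_apply, hx]
        refine h.trans (le_of_eq ?_)
        ring
    _ ≤ _ := by
        rw [integral_const_mul, integral_add i4 i5]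
        exact mul_le_mul_of_nonneg_left (by linarith)
          (mul_nonneg (by linarith) (by positivity))

/-- The potential `|z|^{p-2}` is the sum of a bounded function and of a form-small one. -/
lemma exists_integral_rpow_mul_sq_le (hp : 2 < p) (z : Lp ℝ (ENNReal.ofReal p) ν) {ε : ℝ}
    (hε : 0 < ε) : ∃ C : ℝ, 0 ≤ C ∧ ∀ w : Lp ℝ (ENNReal.ofReal p) ν, MemLp w 2 ν →
      ∫ x, |z x| ^ (p - 2) * |w x| * |w x| ∂ν ≤ C * ∫ x, ‖w x‖ ^ 2 ∂ν + ε * ‖w‖ ^ 2 := by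
  -- The part of `z` where `|z| ≥ M` has norm at most `ε^{1/(p-2)}`, so its power `p - 2` in
  -- Hölder's inequality is at most `ε`; elsewhere the potential is at most `M^{p-2}`.
  obtain ⟨M, hM, hMle⟩ := (Lp.memLp z).eLpNorm_indicator_norm_ge_pos_le (Lp.stronglyMeasurable z)
    (ε := ε ^ (1 / (p - 2))) (by positivity)
  set s : Set α := {x | M ≤ ‖z x‖₊} with hs
  have hsm : MeasurableSet s :=
    measurableSet_le measurable_const (Lp.stronglyMeasurable z).measurable.nnnorm.coe_nnreal_real
  have ha : MemLp (s.indicator z) (ENNReal.ofReal p) ν := (Lp.memLp z).indicator hsm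
  refine ⟨M ^ (p - 2), by positivity, fun w hw2 => ?_⟩
  have hw := Lp.memLp w
  have i1 := integrable_rpow_mul_mul hp ha hw hw
  have i2 : Integrable (fun x => ‖w x‖ ^ 2) ν := hw2.norm.integrable_sq
  have hsmall : (eLpNorm (s.indicator z) (ENNReal.ofReal p) ν).toReal ^ (p - 2) ≤ ε := by
    have h1 := ENNReal.toReal_mono ENNReal.ofReal_ne_top hMle
    rw [ENNReal.toReal_ofReal (by positivity)] at h1
    refine (Real.rpow_le_rpow ENNReal.toReal_nonneg h1 (by linarith)).trans (le_of_eq ?_)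
    rw [← Real.rpow_mul hε.le, one_div_mul_cancel (by linarith), Real.rpow_one]
  calc _ ≤ ∫ x, (M ^ (p - 2) * ‖w x‖ ^ 2 +
        |s.indicator z x| ^ (p - 2) * |w x| * |w x|) ∂ν := by
        refine integral_mono (integrable_rpow_mul_mul hp (Lp.memLp z) hw hw)
          ((i2.const_mul _).add i1) fun x => ?_
        simp only [Real.norm_eq_abs]
        by_cases hx : x ∈ s
        · rw [indicator_of_mem hx]
          have : 0 ≤ M ^ (p - 2) * |w x| ^ 2 := by positivity
          linarith
        · have hx' : |z x| ≤ M := by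
            have : ¬ M ≤ |z x| := hx
            linarith
          have h1 : |z x| ^ (p - 2) ≤ M ^ (p - 2) :=
            Real.rpow_le_rpow (abs_nonneg _) hx' (by linarith)
          have h2 : 0 ≤ |s.indicator z x| ^ (p - 2) * |w x| * |w x| := by positivity
          nlinarith [mul_nonneg (abs_nonneg (w x)) (abs_nonneg (w x))]
    _ ≤ _ := by
        rw [integral_add (i2.const_mul _) i1, integral_const_mul]
        have h := integral_rpow_mul_mul_le hp ha hw hw
        rw [← Lp.norm_def] at h
        have h2 : (eLpNorm (s.indicator z) (ENNReal.ofReal p) ν).toReal ^ (p - 2) * ‖w‖ * ‖w‖ ≤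
            ε * ‖w‖ * ‖w‖ := by gcongr
        linarith

end Lp

/-! ### The derivative of the energy and its local semiconvexity -/

lemma continuousAdd_dual {V : Type*} [NormedAddCommGroup V] [NormedSpace ℝ V] :
    ContinuousAdd (V →L[ℝ] ℝ) := inferInstance

instance (N : ℕ) : ContinuousAdd (X N →L[ℝ] ℝ) := continuousAdd_dual

section Ge3

variable {N : ℕ} [hN : Fact (3 ≤ N)]

/-- The derivative of the energy `E_K` at `v`, as a functional on `X`. -/
def energyDeriv (μ : ℝ) (v : X N) : X N →L[ℝ] ℝ :=
  (innerSL ℝ (gradL N v)).comp (gradL N) + (-μ) • (innerSL ℝ (hardyL v)).comp hardyL +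
    (-beta N) • (innerSL ℝ (fnL N v)).comp (fnL N) +
    (-1 : ℝ) • (powDual (two_lt_twoStar hN.out) (sobL v)).comp sobL

lemma energyDeriv_apply (μ : ℝ) (v w : X N) : energyDeriv μ v w =
    inner ℝ (grad v) (grad w) - μ * inner ℝ (hardyL v) (hardyL w) -
      beta N * inner ℝ (fn v) (fn w) - powDual (two_lt_twoStar hN.out) (sobL v) (sobL w) := by
  have : energyDeriv μ v w = inner ℝ (grad v) (grad w) + -μ * inner ℝ (hardyL v) (hardyL w) +
      -beta N * inner ℝ (fn v) (fn w) +
      -1 * powDual (two_lt_twoStar hN.out) (sobL v) (sobL w) := rfl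
  rw [this]
  ring

lemma continuous_energyDeriv (μ : ℝ) : Continuous (energyDeriv μ : X N → _) := by
  have h : Continuous fun v : X N => powDual (two_lt_twoStar hN.out) (sobL v) :=
    (continuous_powDual _).comp sobL.continuous
  have h1 : Continuous fun v : X N => (innerSL ℝ (gradL N v)).comp (gradL N) :=
    ((innerSL ℝ).continuous.comp (gradL N).continuous).clm_comp continuous_const
  have h2 : Continuous fun v : X N => (innerSL ℝ (hardyL v)).comp (hardyL (N := N)) :=
    ((innerSL ℝ).continuous.comp hardyL.continuous).clm_comp continuous_const
  have h3 : Continuous fun v : X N => (innerSL ℝ (fnL N v)).comp (fnL N) :=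
    ((innerSL ℝ).continuous.comp (fnL N).continuous).clm_comp continuous_const
  exact ((h1.add (h2.const_smul (-μ))).add (h3.const_smul (-beta N))).add
    ((h.clm_comp continuous_const).const_smul (-1 : ℝ))

lemma energyDeriv_self (μ : ℝ) (v : X N) : energyDeriv μ v v = nehari N μ v := by
  have hp := two_lt_twoStar hN.out
  rw [energyDeriv_apply, nehari, quadA_eq, funB_eq, norm_rpow_eq_integral hp, powDual_apply,
    real_inner_self_eq_norm_sq, real_inner_self_eq_norm_sq, real_inner_self_eq_norm_sq]
  congr 1
  refine integral_congr_ae (.of_forall fun x => ?_)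
  have h : |sobL v x| ^ twoStar N = |sobL v x| ^ (twoStar N - 2) * |sobL v x| ^ 2 := by
    rw [← Real.rpow_two, ← Real.rpow_add_of_nonneg (abs_nonneg _) (by linarith) (by norm_num)]
    congr 1
    ring
  simp only [h, sq_abs]
  ring

/-- The quadratic part has the exact remainder `A(z - u) / 2`, whose coercivity must pay for the
remainder of the power. -/
lemma energy_sub_eq (μ : ℝ) (z u : X N) : energy N μ z - energy N μ u - energyDeriv μ u (z - u) =
    1 / 2 * quadA N μ (z - u) - (1 / twoStar N * ‖sobL z‖ ^ twoStar N -
      1 / twoStar N * ‖sobL u‖ ^ twoStar N -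
      powDual (two_lt_twoStar hN.out) (sobL u) (sobL z - sobL u)) := by
  obtain ⟨w, rfl⟩ : ∃ w, z = u + w := ⟨z - u, by abel⟩
  have h1 : ‖grad (u + w)‖ ^ 2 = ‖grad u‖ ^ 2 + 2 * inner ℝ (grad u) (grad w) + ‖grad w‖ ^ 2 :=
    norm_add_sq_real _ _
  have h2 : ‖fn (u + w)‖ ^ 2 = ‖fn u‖ ^ 2 + 2 * inner ℝ (fn u) (fn w) + ‖fn w‖ ^ 2 :=
    norm_add_sq_real _ _
  have h3 : ‖hardyL (u + w)‖ ^ 2 =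
      ‖hardyL u‖ ^ 2 + 2 * inner ℝ (hardyL u) (hardyL w) + ‖hardyL w‖ ^ 2 := by
    rw [map_add, norm_add_sq_real]
  rw [add_sub_cancel_left, energyDeriv_apply, energy, energy, quadA_eq, quadA_eq, quadA_eq,
    funB_eq, funB_eq, h1, h2, h3]
  simp only [map_add, add_sub_cancel_left]
  ring

/-- Near `z`, the energy is semiconvex with respect to the norm of `L²_K`. -/
lemma exists_semiconvex {μ : ℝ} (hμ₁ : μ ≤ ((N : ℝ) - 2) ^ 2 / 8) (z : X N) :
    ∃ M : ℝ, ∃ r > 0, ∀ u : X N, ‖z - u‖ < r →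
      energyDeriv μ u (z - u) ≤ energy N μ z - energy N μ u + M * ‖fn u - fn z‖ ^ 2 := by
  have hp := two_lt_twoStar hN.out
  have hN3 : (3 : ℝ) ≤ N := three_le_cast
  set c : ℝ := (twoStar N - 1) * 2 ^ (twoStar N - 2) with hcdef
  have hc : 0 < c := mul_pos (by linarith) (by positivity)
  obtain ⟨S, hS0, hS⟩ : ∃ S : ℝ, 0 ≤ S ∧ ∀ v : X N, ‖sobL v‖ ≤ S * ‖grad v‖ :=
    ⟨sobConst N, NNReal.coe_nonneg _, norm_sobL_le⟩
  -- Two errors `ε ‖z - u‖²` in the norm of `L^{2*}`, multiplied by `c`, cost at most `2 c ε S² ≤ 1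
  -- / (2N)` of `‖z - u‖²` in `X`, exactly what `A(z - u) / 2` provides. The `+ 1` covers `S = 0`.
  set ε : ℝ := 1 / (4 * N * (c * S ^ 2 + 1)) with hε
  have hε0 : 0 < ε := by positivity
  obtain ⟨C, hC, hCle⟩ := exists_integral_rpow_mul_sq_le hp (sobL z) hε0
  have hr : ∃ r > 0, ∀ t : ℝ, 0 ≤ t → t < r → (S * t) ^ (twoStar N - 2) ≤ ε := by
    have ht : Continuous fun t : ℝ => (S * t) ^ (twoStar N - 2) :=
      (continuous_const.mul continuous_id).rpow_const fun _ => Or.inr (by linarith)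
    have h0 : (fun t : ℝ => (S * t) ^ (twoStar N - 2)) 0 < ε := by
      simp only [mul_zero]
      rwa [Real.zero_rpow (by linarith)]
    obtain ⟨r, hr, h⟩ := Metric.eventually_nhds_iff.1 ((ht.tendsto 0).eventually_lt_const h0)
    exact ⟨r, hr, fun t ht0 htr => (h (by simpa [abs_of_nonneg ht0] using htr)).le⟩
  obtain ⟨r, hr0, hr⟩ := hr
  refine ⟨c * C, r, hr0, fun u hu => ?_⟩
  have hw2 : MemLp (sobL (z - u)) 2 (measK N) :=
    (memLp_congr_ae (coeFn_sobL (z - u))).2 (Lp.memLp _)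
  have e1 := energy_sub_eq μ z u
  have e2 := norm_rpow_remainder_le hp (sobL z) (sobL u)
  rw [← map_sub] at e1 e2
  have e3 := hCle (sobL (z - u)) hw2
  have e4 : ∫ x, ‖sobL (z - u) x‖ ^ 2 ∂(measK N) = ‖fn u - fn z‖ ^ 2 := by
    have : ‖fn u - fn z‖ = ‖fn (z - u)‖ := norm_sub_rev _ _
    rw [this, norm_sq_eq_integral]
    refine integral_congr_ae ?_
    filter_upwards [coeFn_sobL (z - u)] with y hy
    rw [hy]
  have e5 := hS (z - u)
  have e6 := norm_grad_sq_le_quadA hμ₁ (z - u)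
  rw [← norm_eq_norm_grad] at e5 e6
  have e7 : ‖sobL (z - u)‖ ^ (twoStar N - 2) ≤ ε :=
    (Real.rpow_le_rpow (norm_nonneg _) e5 (by linarith)).trans (hr _ (norm_nonneg _) hu)
  have e8 : ‖sobL (z - u)‖ ^ 2 ≤ (S * ‖z - u‖) ^ 2 := pow_le_pow_left₀ (norm_nonneg _) e5 2
  rw [e4] at e3
  have e9 : ‖sobL (z - u)‖ ^ (twoStar N - 2) * ‖sobL (z - u)‖ ^ 2 ≤ ε * ‖sobL (z - u)‖ ^ 2 :=
    mul_le_mul_of_nonneg_right e7 (sq_nonneg _)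
  have e10 : c * (2 * ε * ‖sobL (z - u)‖ ^ 2) ≤ 1 / (2 * N) * ‖z - u‖ ^ 2 := by
    calc c * (2 * ε * ‖sobL (z - u)‖ ^ 2) ≤ c * (2 * ε * (S * ‖z - u‖) ^ 2) := by gcongr
      _ = (c * S ^ 2 / (c * S ^ 2 + 1)) * (1 / (2 * N) * ‖z - u‖ ^ 2) := by
          rw [hε]; field_simp; ring
      _ ≤ 1 * (1 / (2 * N) * ‖z - u‖ ^ 2) := by
          gcongr
          rw [div_le_one (by positivity)]
          linarith
      _ = _ := one_mul _
  have e11 : 1 / 2 * (1 / (N : ℝ) * ‖z - u‖ ^ 2) = 1 / (2 * N) * ‖z - u‖ ^ 2 := by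
    field_simp
  have e12 := mul_le_mul_of_nonneg_left (add_le_add e3 e9) hc.le
  have e13 : c * (C * ‖fn u - fn z‖ ^ 2 + ε * ‖sobL (z - u)‖ ^ 2 + ε * ‖sobL (z - u)‖ ^ 2) =
    c * C * ‖fn u - fn z‖ ^ 2 + c * (2 * ε * ‖sobL (z - u)‖ ^ 2) := by ring
  linarith

end Ge3

/-! ### Gradient flows of locally semiconvex energies -/

section Flow

open Filter Topology

variable {V H : Type*} [NormedAddCommGroup V] [NormedSpace ℝ V] [NormedAddCommGroup H]
  [InnerProductSpace ℝ H] {ι : V →L[ℝ] H} {u : ℝ → V} {G : V → V →L[ℝ] ℝ}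

/-- By `|x₁|² - |x₂|² = ⟨x₁ - x₂, x₁ + x₂⟩`, the increment of the squared distance is the weak
identity tested with `2 z - u(s) - u(t)`. The test vector moves with `s`, which is harmless because
the slopes of `∫ G (u r)` converge in the dual norm. No time derivative of `u` is needed. -/
lemma hasDerivAt_half_norm_sub_sq (hu : Continuous u) (hG : Continuous G)
    (hflow : ∀ w : V, ∀ a b : ℝ, 0 < a → 0 < b →
      inner ℝ (ι (u b) - ι (u a)) (ι w) = -∫ r in a..b, G (u r) w) (z : V) {t : ℝ} (ht : 0 < t) :
    HasDerivAt (fun s => 1 / 2 * ‖ι (u s) - ι z‖ ^ 2) (G (u t) (z - u t)) t := by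
  have hGu : Continuous fun r => G (u r) := hG.comp hu
  have hJ : HasDerivAt (fun s => ∫ r in t..s, G (u r)) (G (u t)) t :=
    intervalIntegral.integral_hasDerivAt_right (hGu.intervalIntegrable _ _)
      hGu.aestronglyMeasurable.stronglyMeasurableAtFilter hGu.continuousAt
  rw [hasDerivAt_iff_tendsto_slope] at hJ ⊢
  have hlim : Tendsto (fun s => slope (fun s => ∫ r in t..s, G (u r)) t s
      ((1 / 2 : ℝ) • ((2 : ℝ) • z - u s - u t))) (𝓝[≠] t)
      (𝓝 (G (u t) ((1 / 2 : ℝ) • ((2 : ℝ) • z - u t - u t)))) := by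
    have hw : Tendsto (fun s => (1 / 2 : ℝ) • ((2 : ℝ) • z - u s - u t)) (𝓝[≠] t)
        (𝓝 ((1 / 2 : ℝ) • ((2 : ℝ) • z - u t - u t))) :=
      (Continuous.tendsto (by fun_prop) t).mono_left nhdsWithin_le_nhds
    exact (isBoundedBilinearMap_apply.continuous.tendsto (_, _)).comp (hJ.prodMk_nhds hw)
  have hval : (1 / 2 : ℝ) • ((2 : ℝ) • z - u t - u t) = z - u t := by
    rw [smul_sub, smul_sub, smul_smul]; norm_num
    rw [sub_sub, ← add_smul]; norm_num
  rw [hval] at hlim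
  refine hlim.congr' ?_
  have hpos : ∀ᶠ s in 𝓝[≠] t, 0 < s := nhdsWithin_le_nhds (lt_mem_nhds ht)
  filter_upwards [hpos] with s hs
  have hf := hflow ((2 : ℝ) • z - u s - u t) t s ht hs
  have hap : (∫ r in t..s, G (u r)) ((2 : ℝ) • z - u s - u t) =
      ∫ r in t..s, G (u r) ((2 : ℝ) • z - u s - u t) :=
    ContinuousLinearMap.intervalIntegral_apply (hGu.intervalIntegrable _ _) _
  simp only [slope_def_module, intervalIntegral.integral_same, sub_zero, smul_apply, map_smul,
    smul_eq_mul]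
  rw [hap, ← neg_eq_iff_eq_neg.2 hf]
  have e1 : ι (u s) - ι (u t) = (ι (u s) - ι z) - (ι (u t) - ι z) := by abel
  have e2 : ι ((2 : ℝ) • z - u s - u t) = -((ι (u s) - ι z) + (ι (u t) - ι z)) := by
    rw [map_sub, map_sub, map_smul, two_smul]; abel
  rw [e1, e2]
  generalize ι (u s) - ι z = x₁
  generalize ι (u t) - ι z = x₂
  rw [inner_neg_right, inner_add_right, inner_sub_left, inner_sub_left,
    real_inner_self_eq_norm_sq, real_inner_self_eq_norm_sq, real_inner_comm x₁ x₂]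
  ring

/-- A gradient flow of a locally semiconvex energy does not increase the energy. -/
lemma antitoneOn_energy_of_flow (hu : Continuous u) (hG : Continuous G)
    (hflow : ∀ w : V, ∀ a b : ℝ, 0 < a → 0 < b →
      inner ℝ (ι (u b) - ι (u a)) (ι w) = -∫ r in a..b, G (u r) w)
    {E : V → ℝ} (hE : Continuous E)
    (hconv : ∀ z : V, ∃ M : ℝ, ∃ r > 0, ∀ x : V, ‖z - x‖ < r →
      G x (z - x) ≤ E z - E x + M * ‖ι x - ι z‖ ^ 2) :
    AntitoneOn (fun s => E (u s)) (Ici 0) := by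
  intro a ha b hb hab
  by_contra! hlt
  have hEu : Continuous fun s => E (u s) := hE.comp hu
  -- the last time before `b` at which the energy is at most its value at `a`
  set T : Set ℝ := {s | s ∈ Icc a b ∧ E (u s) ≤ E (u a)} with hT
  have hTc : IsCompact T := isCompact_Icc.inter_right (isClosed_le hEu continuous_const)
  have hTne : T.Nonempty := ⟨a, ⟨le_rfl, hab⟩, le_rfl⟩
  obtain ⟨t, ⟨⟨hat, htb⟩, htE⟩, htmax⟩ := hTc.exists_isGreatest hTne
  have hgt : ∀ s, t < s → s ≤ b → E (u t) < E (u s) := by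
    intro s hts hsb
    by_contra! hle
    exact absurd (htmax ⟨⟨hat.trans hts.le, hsb⟩, hle.trans htE⟩) (not_le.2 hts)
  have htb' : t < b := lt_of_le_of_ne htb (by rintro rfl; linarith)
  have ht0 : 0 ≤ t := le_trans ha hat
  obtain ⟨M, r, hr, hM⟩ := hconv (u t)
  obtain ⟨η, hη, hηr⟩ : ∃ η > 0, ∀ s, |s - t| < η → ‖u t - u s‖ < r := by
    obtain ⟨η, hη, h⟩ := Metric.continuousAt_iff.1 (hu.continuousAt (x := t)) r hr
    refine ⟨η, hη, fun s hs => ?_⟩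
    have := h (x := s) (by simpa [Real.dist_eq] using hs)
    rwa [dist_comm, dist_eq_norm] at this
  set c : ℝ := min b (t + η / 2) with hc
  have htc : t < c := lt_min htb' (by linarith)
  set y : ℝ → ℝ := fun s => 1 / 2 * ‖ι (u s) - ι (u t)‖ ^ 2 with hy
  have hyc : Continuous y := by fun_prop
  have hyd : ∀ s ∈ Ioo t c, HasDerivAt y (G (u s) (u t - u s)) s := fun s hs =>
    hasDerivAt_half_norm_sub_sq hu hG hflow (u t) (ht0.trans_lt hs.1)
  have hineq : ∀ s ∈ Ioo t c, G (u s) (u t - u s) < 2 * M * y s := by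
    intro s hs
    have h1 := hM (u s) (hηr s (by
      rw [abs_of_pos (by linarith [hs.1])]
      have := hs.2.trans_le (min_le_right _ _)
      linarith))
    have h2 := hgt s hs.1 (hs.2.le.trans (min_le_left _ _))
    simp only [hy]
    linarith
  -- Gronwall for `y' < 2 M y`: the weighted function strictly decreases from `y t = 0`, so `y c <
  -- 0`, which is absurd for a square.
  have hanti : StrictAntiOn (fun s => y s * Real.exp (-(2 * M) * s)) (Icc t c) := by
    refine strictAntiOn_of_hasDerivWithinAt_neg (convex_Icc t c)
      (f' := fun s => G (u s) (u t - u s) * Real.exp (-(2 * M) * s) +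
        y s * (Real.exp (-(2 * M) * s) * (-(2 * M)))) (by fun_prop) ?_ ?_
    · intro s hs
      rw [interior_Icc] at hs
      have h2 : HasDerivAt (fun s => Real.exp (-(2 * M) * s))
          (Real.exp (-(2 * M) * s) * (-(2 * M))) s := by
        simpa using ((hasDerivAt_id s).const_mul (-(2 * M))).exp
      exact ((hyd s hs).mul h2).hasDerivWithinAt
    · intro s hs
      rw [interior_Icc] at hs
      have h1 := hineq s hs
      have h2 := Real.exp_pos (-(2 * M) * s)
      nlinarith
  have h1 := hanti (left_mem_Icc.2 htc.le) (right_mem_Icc.2 htc.le) htc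
  have h2 : y t = 0 := by simp [hy]
  have h3 : 0 ≤ y c := by positivity
  simp only [h2, zero_mul] at h1
  nlinarith [Real.exp_pos (-(2 * M) * c)]

end Flow

/-! ### Weak solutions are gradient flows -/

/-- The du Bois-Reymond lemma for continuous functions on an interval. -/
lemma eq_of_forall_integral_deriv_mul_eq_zero {k : ℝ → ℝ} (hk : Continuous k) {S : ℝ}
    (h : ∀ φ : ℝ → ℝ, ContDiff ℝ ∞ φ → HasCompactSupport φ → tsupport φ ⊆ Ioo 0 S →
      ∫ s, deriv φ s * k s = 0) {a b : ℝ} (ha : a ∈ Ioo 0 S) (hb : b ∈ Ioo 0 S) : k a = k b := by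
  have hS : 0 < S := ha.1.trans ha.2
  set f : ContDiffBump (S / 2) := ⟨S / 8, S / 4, by linarith, by linarith⟩ with hf
  set η : ℝ → ℝ := f.normed volume with hηdef
  have hη : ContDiff ℝ ∞ η := f.contDiff_normed
  have hηc : HasCompactSupport η := f.hasCompactSupport_normed
  have hη1 : ∫ s, η s = 1 := f.integral_normed
  have hηs : tsupport η ⊆ Ioo 0 S := by
    rw [hηdef, f.tsupport_normed_eq, Real.closedBall_eq_Icc]
    intro x hx
    simp only [hf] at hx
    constructor <;> linarith [hx.1, hx.2]
  set c : ℝ := ∫ s, η s * k s with hc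
  have hconst : ∀ᵐ s, s ∈ Ioo 0 S → k s - c = 0 := by
    refine isOpen_Ioo.ae_eq_zero_of_integral_contDiff_smul_eq_zero
      ((hk.sub continuous_const).locallyIntegrable.locallyIntegrableOn _) ?_
    intro ψ hψ hψc hψs
    -- Subtracting a multiple of the unit mass bump gives mean zero, so the primitive of `χ` is
    -- again compactly supported in `(0, S)` and is an admissible test function.
    set χ : ℝ → ℝ := fun s => ψ s - (∫ r, ψ r) * η s with hχdef
    have hχ : ContDiff ℝ ∞ χ := hψ.sub (contDiff_const.mul hη)
    have iψ : Integrable ψ := hψ.continuous.integrable_of_hasCompactSupport hψc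
    have iη : Integrable η := hη.continuous.integrable_of_hasCompactSupport hηc
    have hχ0 : ∫ s, χ s = 0 := by
      rw [hχdef, integral_sub iψ (iη.const_mul _), integral_const_mul, hη1, mul_one, sub_self]
    set K : Set ℝ := tsupport ψ ∪ tsupport η with hK
    have hKc : IsCompact K := hψc.union hηc
    have hKs : K ⊆ Ioo 0 S := union_subset hψs hηs
    have hKne : K.Nonempty := by
      obtain ⟨x, hx⟩ : ∃ x, η x ≠ 0 := by
        by_contra! hall
        simp [hall] at hη1
      exact ⟨x, Or.inr (subset_tsupport _ hx)⟩
    have hm := hKs (hKc.sInf_mem hKne)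
    have hM := hKs (hKc.sSup_mem hKne)
    have hKI : K ⊆ Icc (sInf K) (sSup K) := fun x hx =>
      ⟨csInf_le hKc.bddBelow hx, le_csSup hKc.bddAbove hx⟩
    have hχK : ∀ x, x ∉ K → χ x = 0 := by
      intro x hx
      have h1 : ψ x = 0 := image_eq_zero_of_notMem_tsupport fun hx' => hx (Or.inl hx')
      have h2 : η x = 0 := image_eq_zero_of_notMem_tsupport fun hx' => hx (Or.inr hx')
      simp [hχdef, h1, h2]
    set φ : ℝ → ℝ := fun t => ∫ s in (0 : ℝ)..t, χ s with hφdef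
    have hφd : ∀ t, HasDerivAt φ (χ t) t := fun t =>
      intervalIntegral.integral_hasDerivAt_right (hχ.continuous.intervalIntegrable _ _)
        hχ.continuous.aestronglyMeasurable.stronglyMeasurableAtFilter hχ.continuous.continuousAt
    have hφ' : deriv φ = χ := funext fun t => (hφd t).deriv
    have hφ : ContDiff ℝ ∞ φ :=
      contDiff_infty_iff_deriv.2 ⟨fun t => (hφd t).differentiableAt, hφ' ▸ hχ⟩
    have hφ0 : ∀ t, t ∉ Icc (sInf K) (sSup K) → φ t = 0 := by
      intro t ht
      rcases lt_or_ge t (sInf K) with h1 | h1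
      · refine (intervalIntegral.integral_congr (g := fun _ => 0) fun s hs => ?_).trans (by simp)
        refine hχK s fun hsK => ?_
        have h2 := (hKI hsK).1
        have h3 := hs.2
        have : max 0 t < sInf K := max_lt hm.1 h1
        linarith
      · have h2 : sSup K < t := by
          by_contra! h2
          exact ht ⟨h1, h2⟩
        simp only [hφdef]
        rw [intervalIntegral.integral_eq_integral_of_support_subset, hχ0]
        intro x hx
        have hxK : x ∈ K := by
          by_contra hxK
          exact hx (hχK x hxK)
        exact ⟨(hKs hxK).1, ((hKI hxK).2.trans_lt h2).le⟩
    have hφs : tsupport φ ⊆ Icc (sInf K) (sSup K) :=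
      closure_minimal (fun x hx => by
        by_contra hx'
        exact hx (hφ0 x hx')) isClosed_Icc
    have h0 := h φ hφ (HasCompactSupport.intro isCompact_Icc hφ0)
      (hφs.trans fun x hx => ⟨hm.1.trans_le hx.1, hx.2.trans_lt hM.2⟩)
    rw [hφ'] at h0
    have iψk : Integrable fun s => ψ s * k s :=
      (hψ.continuous.mul hk).integrable_of_hasCompactSupport hψc.mul_right
    have iηk : Integrable fun s => η s * k s :=
      (hη.continuous.mul hk).integrable_of_hasCompactSupport hηc.mul_right
    have h1 : ∫ s, χ s * k s = (∫ s, ψ s * k s) - (∫ r, ψ r) * c := by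
      rw [hc, ← integral_const_mul, ← integral_sub iψk (iηk.const_mul _)]
      congr 1
      funext s
      simp only [hχdef]
      ring
    have h2 : ∫ s, ψ s • (k s - c) = (∫ s, ψ s * k s) - (∫ r, ψ r) * c := by
      rw [← integral_mul_const, ← integral_sub iψk (iψ.mul_const _)]
      congr 1
      funext s
      simp only [smul_eq_mul]
      ring
    rw [h2, ← h1, h0]
  have hEq : EqOn k (fun _ => c) (Ioo 0 S) := by
    refine Measure.eqOn_open_of_ae_eq (μ := volume) ?_ isOpen_Ioo hk.continuousOn continuousOn_const
    rw [Filter.EventuallyEq, ae_restrict_iff' measurableSet_Ioo]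
    filter_upwards [hconst] with s hs hsI
    linarith [hs hsI]
  rw [hEq ha, hEq hb]

lemma integral_mul_eq_inner {N : ℕ} (f g : L2K N) : ∫ y, f y * g y ∂(measK N) = inner ℝ f g := by
  rw [L2.inner_def]
  simp [mul_comm]

section Ge3

variable {N : ℕ} [hN : Fact (3 ≤ N)]

/-- Identifies the equation as the gradient flow `v_s = -E_K'(v)`: the term `(∇v, ∇w)_K` cancels
against the left side. -/
lemma integral_nonlinearity_eq (μ : ℝ) (v w : X N) :
    ∫ y, (|fn v y| ^ (twoStar N - 2) * fn v y + μ * (fn v y / ‖y‖ ^ 2) + beta N * fn v y) * fn w y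
      ∂(measK N) = inner ℝ (grad v) (grad w) - energyDeriv μ v w := by
  have hp := two_lt_twoStar hN.out
  have i1 := integrable_abs_rpow_mul_self_mul hp (Lp.memLp (sobL v)) (Lp.memLp (sobL v))
    (Lp.memLp (sobL w))
  have i2 : Integrable (fun y => hardyL v y * hardyL w y) (measK N) :=
    (Lp.memLp (hardyL v)).integrable_mul (Lp.memLp (hardyL w))
  have i3 : Integrable (fun y => fn v y * fn w y) (measK N) :=
    (Lp.memLp (fn v)).integrable_mul (Lp.memLp (fn w))
  rw [energyDeriv_apply, powDual_apply, ← integral_mul_eq_inner, ← integral_mul_eq_inner]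
  have hsum : ∫ y, (|fn v y| ^ (twoStar N - 2) * fn v y + μ * (fn v y / ‖y‖ ^ 2) +
      beta N * fn v y) * fn w y ∂(measK N) =
      ∫ y, (|sobL v y| ^ (twoStar N - 2) * sobL v y * sobL w y + μ * (hardyL v y * hardyL w y) +
        beta N * (fn v y * fn w y)) ∂(measK N) := by
    refine integral_congr_ae ?_
    filter_upwards [coeFn_sobL v, coeFn_sobL w, coeFn_hardyL v, coeFn_hardyL w] with y h1 h2 h3 h4
    rw [h1, h2, h3, h4]
    ring
  have i12 : Integrable (fun y => |sobL v y| ^ (twoStar N - 2) * sobL v y * sobL w y +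
      μ * (hardyL v y * hardyL w y)) (measK N) := i1.add (i2.const_mul μ)
  rw [hsum, integral_add i12 (i3.const_mul _), integral_add i1 (i2.const_mul _),
    integral_const_mul, integral_const_mul]
  ring

/-- Differentiating the integrated equation gives `(v_s, w)_K = -E_K'(v) w` for almost every time.
Hence `(v, w)_K + ∫ E_K'(v) w` has zero weak derivative and, being continuous, is constant. -/
lemma IsWeakSolution.inner_sub_eq {μ : ℝ} {v₀ : X N} {S : ℝ} {v u : ℝ → X N}
    (hv : IsWeakSolution N μ v₀ S v) (hu : Continuous u) (huv : ∀ s, 0 ≤ s → u s = v s) (w : X N)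
    {a b : ℝ} (ha : a ∈ Ioo 0 S) (hb : b ∈ Ioo 0 S) :
    inner ℝ (fn (u b) - fn (u a)) (fn w) = -∫ r in a..b, energyDeriv μ (u r) w := by
  have hS : 0 < S := ha.1.trans ha.2
  obtain ⟨vs, hvs, hweak, heq⟩ := hv.equation
  have hfu : Continuous fun s => fn (u s) := (fnL N).continuous.comp hu
  have hgu : Continuous fun s => grad (u s) := (gradL N).continuous.comp hu
  set g : ℝ → ℝ := fun r => energyDeriv μ (u r) w with hg
  have hgc : Continuous g :=
    ((ContinuousLinearMap.apply ℝ ℝ w).continuous.comp (continuous_energyDeriv μ)).comp hu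
  have hvsi : IntegrableOn vs (Ioo 0 S) := hvs.integrable (by norm_num)
  have hinn : IntegrableOn (fun τ => inner ℝ (vs τ) (fn w)) (Ioo 0 S) := hvsi.inner_const _
  -- the equation, pointwise in time
  have hae : ∀ᵐ τ, τ ∈ Ioo 0 S → inner ℝ (vs τ) (fn w) = -g τ := by
    have hint : IntervalIntegrable (fun τ => inner ℝ (vs τ) (fn w) + g τ) volume 0 S := by
      refine IntervalIntegrable.add ?_ (hgc.intervalIntegrable _ _)
      rwa [intervalIntegrable_iff_integrableOn_Ioo_of_le hS.le]
    have hzero : ∀ s ∈ Ioo 0 S, ∫ τ in (0 : ℝ)..s, (inner ℝ (vs τ) (fn w) + g τ) = 0 := by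
      intro s hs
      have h1 := heq w s hs
      have iL : IntervalIntegrable (fun τ => inner ℝ (vs τ) (fn w)) volume 0 s := by
        rw [intervalIntegrable_iff_integrableOn_Ioo_of_le hs.1.le]
        exact hinn.mono_set (Ioo_subset_Ioo_right hs.2.le)
      have iG : IntervalIntegrable (fun τ => (inner ℝ (grad (u τ)) (grad w) : ℝ)) volume 0 s :=
        Continuous.intervalIntegrable (by fun_prop) _ _
      have e1 : ∫ τ in (0 : ℝ)..s, ((∫ y, vs τ y * fn w y ∂(measK N)) +
          ∫ y, inner ℝ (grad (v τ) y) (grad w y) ∂(measK N)) =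
          ∫ τ in (0 : ℝ)..s, (inner ℝ (vs τ) (fn w) + inner ℝ (grad (u τ)) (grad w)) := by
        refine intervalIntegral.integral_congr fun τ hτ => ?_
        rw [uIcc_of_le hs.1.le] at hτ
        simp only [integral_mul_eq_inner, huv τ hτ.1, L2.inner_def (grad (v τ)) (grad w)]
      have e2 : ∫ τ in (0 : ℝ)..s, ∫ y, (|fn (v τ) y| ^ (twoStar N - 2) * fn (v τ) y +
          μ * (fn (v τ) y / ‖y‖ ^ 2) + beta N * fn (v τ) y) * fn w y ∂(measK N) =
          ∫ τ in (0 : ℝ)..s, (inner ℝ (grad (u τ)) (grad w) - g τ) := by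
        refine intervalIntegral.integral_congr fun τ hτ => ?_
        rw [uIcc_of_le hs.1.le] at hτ
        simp only [integral_nonlinearity_eq, hg, huv τ hτ.1]
      rw [e1, e2, intervalIntegral.integral_add iL iG,
        intervalIntegral.integral_sub iG (hgc.intervalIntegrable _ _)] at h1
      rw [intervalIntegral.integral_add iL (hgc.intervalIntegrable _ _)]
      linarith
    -- Lebesgue differentiation of a primitive that vanishes identically on `(0, S)`.
    filter_upwards [hint.ae_hasDerivAt_integral] with τ hτ hτI
    rw [uIcc_of_le hS.le] at hτ
    have hd := hτ ⟨hτI.1.le, hτI.2.le⟩ 0 ⟨le_rfl, hS.le⟩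
    have hd0 : HasDerivAt (fun x => ∫ t in (0 : ℝ)..x, (inner ℝ (vs t) (fn w) + g t)) 0 τ := by
      refine (hasDerivAt_const τ (0 : ℝ)).congr_of_eventuallyEq ?_
      filter_upwards [Ioo_mem_nhds hτI.1 hτI.2] with x hx
      exact hzero x hx
    linarith [hd.unique hd0]
  have hGd : ∀ s, HasDerivAt (fun s => ∫ r in (0 : ℝ)..s, g r) (g s) s := fun s =>
    intervalIntegral.integral_hasDerivAt_right (hgc.intervalIntegrable _ _)
      hgc.aestronglyMeasurable.stronglyMeasurableAtFilter hgc.continuousAt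
  have hGc : Continuous fun s => ∫ r in (0 : ℝ)..s, g r :=
    continuous_iff_continuousAt.2 fun s => (hGd s).continuousAt
  have hkey := eq_of_forall_integral_deriv_mul_eq_zero (S := S)
    (k := fun s => inner ℝ (fn (u s)) (fn w) + ∫ r in (0 : ℝ)..s, g r) (by fun_prop) (by
      intro φ hφ hφc hφs
      have hφ' : Continuous (deriv φ) := hφ.continuous_deriv (by simp)
      have hφ0 : ∀ s, s ∉ Ioo 0 S → φ s = 0 := fun s hs =>
        image_eq_zero_of_notMem_tsupport fun hs' => hs (hφs hs')
      have hφd0 : ∀ s, s ∉ Ioo 0 S → deriv φ s = 0 := fun s hs =>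
        image_eq_zero_of_notMem_tsupport fun hs' => hs (hφs (tsupport_deriv_subset hs'))
      have i1 : Integrable (fun s => deriv φ s * inner ℝ (fn (u s)) (fn w)) :=
        Continuous.integrable_of_hasCompactSupport (by fun_prop) (hφc.deriv.mul_right)
      have i2 : Integrable (fun s => deriv φ s * ∫ r in (0 : ℝ)..s, g r) :=
        Continuous.integrable_of_hasCompactSupport (by fun_prop) (hφc.deriv.mul_right)
      have i3 : Integrable (fun s => φ s * g s) :=
        (hφ.continuous.mul hgc).integrable_of_hasCompactSupport hφc.mul_right
      have i4 : Integrable (fun s => φ s * ∫ r in (0 : ℝ)..s, g r) :=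
        (hφ.continuous.mul hGc).integrable_of_hasCompactSupport hφc.mul_right
      have p1 : ∫ s, deriv φ s * ∫ r in (0 : ℝ)..s, g r = -∫ s, φ s * g s := by
        have := integral_mul_deriv_eq_deriv_mul_of_integrable
          (u := φ) (v := fun s => ∫ r in (0 : ℝ)..s, g r) (u' := deriv φ) (v' := g)
          (fun s _ => (hφ.differentiable (by simp) s).hasDerivAt) (fun s _ => hGd s) i3 i2 i4
        linarith
      have p2 : ∫ s, deriv φ s * inner ℝ (fn (u s)) (fn w) = ∫ s, φ s * g s := by
        have hw := congrArg (fun x => inner ℝ (fn w) x) (hweak φ hφ hφc hφs)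
        simp only [inner_neg_right] at hw
        have j1 : IntegrableOn (fun s => deriv φ s • fn (v s)) (Ioo 0 S) := by
          refine IntegrableOn.congr_fun (f := fun s => deriv φ s • fn (u s)) ?_ ?_ measurableSet_Ioo
          · exact ((hφ'.smul hfu).integrableOn_Icc (a := 0) (b := S)).mono_set Ioo_subset_Icc_self
          · intro s hs
            simp only [huv s hs.1.le]
        have j2 : IntegrableOn (fun s => φ s • vs s) (Ioo 0 S) := by
          obtain ⟨C, hC⟩ := hφc.exists_bound_of_continuous hφ.continuous
          exact hvsi.bdd_smul C hφ.continuous.aestronglyMeasurable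
            (.of_forall fun s => hC s)
        rw [← integral_inner j1, ← integral_inner j2] at hw
        rw [← setIntegral_eq_integral_of_forall_compl_eq_zero (s := Ioo 0 S) (fun s hs => by
            rw [hφd0 s hs, zero_mul]),
          ← setIntegral_eq_integral_of_forall_compl_eq_zero (s := Ioo 0 S)
            (f := fun s => φ s * g s) (fun s hs => by rw [hφ0 s hs, zero_mul])]
        have q1 : ∫ s in Ioo 0 S, deriv φ s * inner ℝ (fn (u s)) (fn w) =
            ∫ s in Ioo 0 S, inner ℝ (fn w) (deriv φ s • fn (v s)) := by
          refine setIntegral_congr_fun measurableSet_Ioo fun s hs => ?_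
          simp only [inner_smul_right, huv s hs.1.le]
          rw [real_inner_comm]
        have q2 : ∫ s in Ioo 0 S, φ s * g s = -∫ s in Ioo 0 S, inner ℝ (fn w) (φ s • vs s) := by
          rw [← integral_neg]
          refine setIntegral_congr_ae measurableSet_Ioo ?_
          filter_upwards [hae] with s hs hsI
          rw [inner_smul_right, real_inner_comm, hs hsI]
          ring
        rw [q1, q2, hw]
      simp only [mul_add]
      rw [integral_add i1 i2, p1, p2]
      ring) ha hb
  rw [inner_sub_left, ← intervalIntegral.integral_interval_sub_left (hgc.intervalIntegrable 0 b)
    (hgc.intervalIntegrable 0 a)]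
  linarith

end Ge3

/-! ### The potential well -/

lemma depthMod_le {N : ℕ} {μ δ : ℝ} {v : X N} (h : nehariMod N μ δ v = 0) (hv : ‖grad v‖ ≠ 0) :
    depthMod N μ δ ≤ (energy N μ v : EReal) :=
  iInf₂_le v ⟨h, hv⟩

section Ge3

variable {N : ℕ} [hN : Fact (3 ≤ N)]

/-- Coercivity makes `A` at least `‖x‖² / N`, while Sobolev bounds `B` by a multiple of `‖x‖^{2*}`,
of higher order at `0`. -/
lemma nehari_nonneg_of_norm_lt {μ : ℝ} (hμ₁ : μ ≤ ((N : ℝ) - 2) ^ 2 / 8) :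
    ∃ r > 0, ∀ x : X N, ‖x‖ < r → 0 ≤ nehari N μ x := by
  have hp := two_lt_twoStar hN.out
  have hN3 : (3 : ℝ) ≤ N := three_le_cast
  obtain ⟨S, hS0, hS⟩ : ∃ S : ℝ, 0 ≤ S ∧ ∀ v : X N, ‖sobL v‖ ≤ S * ‖grad v‖ :=
    ⟨sobConst N, NNReal.coe_nonneg _, norm_sobL_le⟩
  have ht : Continuous fun t : ℝ => (S * t) ^ (twoStar N - 2) * S ^ 2 :=
    ((continuous_const.mul continuous_id).rpow_const fun _ => Or.inr (by linarith)).mul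
      continuous_const
  have h0 : (fun t : ℝ => (S * t) ^ (twoStar N - 2) * S ^ 2) 0 < 1 / N := by
    simp only [mul_zero]
    rw [Real.zero_rpow (by linarith), zero_mul]
    positivity
  obtain ⟨r, hr, h⟩ := Metric.eventually_nhds_iff.1 ((ht.tendsto 0).eventually_lt_const h0)
  refine ⟨r, hr, fun x hx => ?_⟩
  have h1 := (h (y := ‖x‖) (by simpa using hx)).le
  have h2 := norm_grad_sq_le_quadA hμ₁ x
  have h3 := hS x
  rw [← norm_eq_norm_grad] at h2 h3
  have h4 : funB N x ≤ (S * ‖x‖) ^ twoStar N := by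
    rw [funB_eq]
    exact Real.rpow_le_rpow (norm_nonneg _) h3 (by linarith)
  have h5 : (S * ‖x‖) ^ twoStar N = (S * ‖x‖) ^ (twoStar N - 2) * S ^ 2 * ‖x‖ ^ 2 := by
    rw [mul_assoc, ← mul_pow, ← Real.rpow_two, ← Real.rpow_add_of_nonneg (by positivity)
      (by linarith) (by norm_num)]
    congr 1
    ring
  have h6 := mul_le_mul_of_nonneg_right h1 (sq_nonneg ‖x‖)
  rw [nehari]
  linarith

lemma energy_pos_of_nehari_pos (μ : ℝ) {v : X N} (h : 0 < nehari N μ v) :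
    0 < energy N μ v := by
  have hp := two_lt_twoStar hN.out
  have hB := funB_nonneg v
  rw [nehari] at h
  have h1 : 1 / twoStar N * funB N v ≤ 1 / 2 * funB N v := by
    gcongr
  rw [energy]
  linarith

lemma energy_smul (μ : ℝ) {c : ℝ} (hc : 0 ≤ c) (v : X N) : energy N μ (c • v) =
    1 / 2 * (c ^ 2 * quadA N μ v) - 1 / twoStar N * (c ^ twoStar N * funB N v) := by
  rw [energy, quadA_smul, funB_smul hc]

lemma norm_grad_smul (c : ℝ) (v : X N) : ‖grad (c • v)‖ = |c| * ‖grad v‖ := by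
  rw [← norm_eq_norm_grad, norm_smul, norm_eq_norm_grad, Real.norm_eq_abs]

/-- A root of `d(δ) = e` with `e > 0` is positive. -/
lemma pos_of_depthMod_eq {μ : ℝ} (hμ₁ : μ ≤ ((N : ℝ) - 2) ^ 2 / 8) {δ e : ℝ} (he : 0 < e)
    (hδ : depthMod N μ δ = (e : EReal)) : 0 < δ := by
  by_contra! hle
  -- On an empty set the infimum would be `⊤`, which is not a real number.
  obtain ⟨v, hv, hv0⟩ : (nehariSetMod N μ δ).Nonempty := by
    by_contra! hemp
    rw [depthMod, hemp] at hδ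
    simp at hδ
  have hA := quadA_pos hμ₁ hv0
  have hB := funB_nonneg v
  rw [nehariMod] at hv
  have hB0 : funB N v = 0 := by nlinarith
  have hδ0 : δ = 0 := by
    have : δ * quadA N μ v = 0 := by linarith
    exact (mul_eq_zero.1 this).resolve_right hA.ne'
  have hsc : ∀ c : ℝ, 0 < c → e ≤ 1 / 2 * (c ^ 2 * quadA N μ v) := by
    intro c hc
    have h1 : nehariMod N μ δ (c • v) = 0 := by
      rw [nehariMod, quadA_smul, funB_smul hc.le, hB0, hδ0]
      ring
    have h2 := depthMod_le h1 (by rw [norm_grad_smul]; exact mul_ne_zero (abs_ne_zero.2 hc.ne') hv0)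
    rw [hδ, EReal.coe_le_coe_iff, energy_smul μ hc.le, hB0] at h2
    linarith
  -- For `δ = 0` and `B(v) = 0` the whole ray through `v` is admissible; this dilation has energy `e
  -- / 2 < e`.
  have h := hsc (√(e / quadA N μ v)) (by positivity)
  rw [Real.sq_sqrt (by positivity), div_mul_cancel₀ _ hA.ne'] at h
  linarith

/-- Inside the well, `D_{K,δ}` is nonnegative at the roots of `d(δ) = e`. -/
lemma funB_le_mul_quadA {μ : ℝ} (hμ₁ : μ ≤ ((N : ℝ) - 2) ^ 2 / 8) {δ e : ℝ} (he : 0 < e)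
    (hδ : depthMod N μ δ = (e : EReal)) {v : X N} (hE : energy N μ v ≤ e)
    (hD : 0 ≤ nehari N μ v) : funB N v ≤ δ * quadA N μ v := by
  have hp := two_lt_twoStar hN.out
  have hδ0 := pos_of_depthMod_eq hμ₁ he hδ
  by_cases hv : ‖grad v‖ = 0
  · have hv0 : v = 0 := by rw [← norm_eq_zero, norm_eq_norm_grad, hv]
    have hA := norm_grad_sq_le_quadA hμ₁ v
    have hB : funB N v = 0 := by
      rw [funB_eq, hv0, map_zero, norm_zero, Real.zero_rpow (by linarith)]
    rw [hB]
    rw [hv] at hA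
    exact mul_nonneg hδ0.le (by simpa using hA)
  have hA := quadA_pos hμ₁ hv
  by_contra! hlt
  have hB : 0 < funB N v := (mul_pos hδ0 hA).trans hlt
  set θ : ℝ := δ * quadA N μ v / funB N v with hθ
  have hθ0 : 0 < θ := by positivity
  have hθ1 : θ < 1 := by rwa [hθ, div_lt_one hB]
  -- the dilation `c • v` with `c^{p-2} = θ` lies on the modified Nehari manifold
  set c : ℝ := θ ^ (1 / (twoStar N - 2)) with hc
  have hc0 : 0 < c := by positivity
  have hc1 : c < 1 := Real.rpow_lt_one hθ0.le hθ1 (one_div_pos.2 (by linarith))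
  have hcp : c ^ twoStar N = c ^ 2 * θ := by
    have h1 : c ^ (twoStar N - 2) = θ := by
      rw [hc, ← Real.rpow_mul hθ0.le, one_div_mul_cancel (by linarith), Real.rpow_one]
    rw [← h1, ← Real.rpow_two, ← Real.rpow_add hc0]
    congr 1
    ring
  have h1 : nehariMod N μ δ (c • v) = 0 := by
    rw [nehariMod, quadA_smul, funB_smul hc0.le, hcp, hθ]
    field_simp
    ring
  have h2 := depthMod_le h1 (by rw [norm_grad_smul]; exact mul_ne_zero (abs_ne_zero.2 hc0.ne') hv)
  rw [hδ, EReal.coe_le_coe_iff, energy_smul μ hc0.le] at h2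
  -- Bernoulli at `c²` with exponent `2* / 2` gives `(1 - c^{2*}) / 2* < (1 - c²) / 2`. With `B ≤ A`
  -- and `B > 0` this makes the energy of `c • v` strictly smaller than that of `v`.
  have h3 := one_add_mul_self_lt_rpow_one_add (s := c ^ 2 - 1) (by nlinarith [sq_nonneg c])
    (by nlinarith) (p := twoStar N / 2) (by linarith)
  have h4 : (1 + (c ^ 2 - 1)) ^ (twoStar N / 2) = c ^ twoStar N := by
    rw [add_sub_cancel, ← Real.rpow_two, ← Real.rpow_mul hc0.le]
    congr 1
    ring
  rw [h4] at h3
  rw [energy] at hE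
  rw [nehari] at hD
  have h5 : 1 / twoStar N * (1 - c ^ twoStar N) < 1 / 2 * (1 - c ^ 2) := by
    have : 1 - c ^ twoStar N < twoStar N / 2 * (1 - c ^ 2) := by linarith
    calc 1 / twoStar N * (1 - c ^ twoStar N) < 1 / twoStar N * (twoStar N / 2 * (1 - c ^ 2)) := by
          gcongr
      _ = _ := by field_simp
  have h6 : 0 < 1 - c ^ 2 := by nlinarith
  have h7 := mul_lt_mul_of_pos_right h5 hB
  have h8 : 1 / 2 * (1 - c ^ 2) * funB N v ≤ 1 / 2 * (1 - c ^ 2) * quadA N μ v :=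
    mul_le_mul_of_nonneg_left (by linarith) (by linarith)
  linarith

/-- The potential well is invariant along curves of energy at most `e < d`. -/
lemma nehari_nonneg_of_curve {μ : ℝ} (hμ₁ : μ ≤ ((N : ℝ) - 2) ^ 2 / 8) {u : ℝ → X N}
    (hu : Continuous u) {e : ℝ} (he : (e : EReal) < depth N μ) (hE : ∀ s, energy N μ (u s) ≤ e)
    (h0 : 0 ≤ nehari N μ (u 0)) (s : ℝ) : 0 ≤ nehari N μ (u s) := by
  have hc : Continuous fun s => nehari N μ (u s) := (continuous_nehari μ).comp hu
  have hclopen : IsClopen {s | 0 ≤ nehari N μ (u s)} := by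
    refine ⟨isClosed_le continuous_const hc, isOpen_iff_mem_nhds.2 fun t ht => ?_⟩
    have ht' : 0 ≤ nehari N μ (u t) := ht
    rcases ht'.eq_or_lt with h | h
    · have hz : u t = 0 := by
        by_contra hne
        have h1 : depth N μ ≤ (energy N μ (u t) : EReal) := iInf₂_le (u t) ⟨h.symm, hne⟩
        exact absurd (he.trans_le h1) (not_lt.2 (EReal.coe_le_coe_iff.2 (hE t)))
      obtain ⟨r, hr, hrr⟩ := nehari_nonneg_of_norm_lt (N := N) hμ₁
      have h2 : ∀ᶠ s in nhds t, ‖u s‖ < r :=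
        (hu.norm.tendsto t).eventually_lt_const (by rwa [hz, norm_zero])
      filter_upwards [h2] with s hs
      exact hrr _ hs
    · filter_upwards [(hc.tendsto t).eventually_const_lt h] with s hs
      exact le_of_lt hs
  have huniv := hclopen.eq_univ ⟨0, h0⟩
  have : s ∈ {s | 0 ≤ nehari N μ (u s)} := huniv ▸ mem_univ s
  exact this

/-- Freezing the solution at `v 0` for negative times gives a curve continuous on all of `ℝ`;
continuity of the gradient suffices because `gradL N` is an isometry. -/
lemma IsGlobalWeakSolution.continuous_max {μ : ℝ} {v₀ : X N} {v : ℝ → X N}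
    (hv : IsGlobalWeakSolution N μ v₀ v) : Continuous fun s => v (max s 0) := by
  have hiso : Isometry (gradL N) :=
    AddMonoidHomClass.isometry_of_norm _ fun x => (norm_eq_norm_grad x).symm
  rw [← hiso.comp_continuous_iff]
  have hon : ContinuousOn (fun s => grad (v s)) (Ici 0) := by
    intro s hs
    have hs' : (0 : ℝ) ≤ s := hs
    have h := (hv (s + 1) (by linarith)).continuous s ⟨hs', by linarith⟩
    refine h.mono_of_mem_nhdsWithin ?_
    rw [← Ici_inter_Iio]
    exact inter_mem_nhdsWithin _ (Iio_mem_nhds (by linarith))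
  exact hon.comp_continuous (by fun_prop) fun s => le_max_right s 0


/-- Exponential decay in `L²_K` of the global weak solutions starting in the potential well. -/
lemma IsGlobalWeakSolution.norm_fn_sq_le {μ : ℝ} (hμ₁ : μ ≤ ((N : ℝ) - 2) ^ 2 / 8) {v₀ : X N}
    (hE : (energy N μ v₀ : EReal) < depth N μ) (hD : 0 < nehari N μ v₀) {δ₁ : ℝ}
    (hδ₁ : depthMod N μ δ₁ = (energy N μ v₀ : EReal)) {v : ℝ → X N}
    (hv : IsGlobalWeakSolution N μ v₀ v) (s : ℝ) (hs : 0 ≤ s) :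
    ‖fn (v s)‖ ^ 2 ≤ ‖fn v₀‖ ^ 2 * Real.exp (-(1 / 2) * (1 - δ₁) * s) := by
  set u : ℝ → X N := fun s => v (max s 0) with hudef
  have hu : Continuous u := hv.continuous_max
  have huv : ∀ s, 0 ≤ s → u s = v s := fun s hs => by simp [hudef, max_eq_left hs]
  have hv0 : v 0 = v₀ := (hv 1 one_pos).initial
  have hu0 : ∀ s, s ≤ 0 → u s = v₀ := fun s hs => by simp [hudef, max_eq_right hs, hv0]
  have hflow : ∀ w : X N, ∀ a b : ℝ, 0 < a → 0 < b →
      inner ℝ (fnL N (u b) - fnL N (u a)) (fnL N w) = -∫ r in a..b, energyDeriv μ (u r) w :=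
    fun w a b ha hb => (hv (max a b + 1) (by positivity)).inner_sub_eq hu huv w
      ⟨ha, by linarith [le_max_left a b]⟩ ⟨hb, by linarith [le_max_right a b]⟩
  have hG := continuous_energyDeriv (N := N) μ
  have hanti := antitoneOn_energy_of_flow hu hG hflow (continuous_energy μ)
    (exists_semiconvex hμ₁)
  have hEn : ∀ s, energy N μ (u s) ≤ energy N μ v₀ := by
    intro s
    rcases le_total s 0 with hs | hs
    · rw [hu0 s hs]
    · have := hanti (mem_Ici.2 le_rfl) (mem_Ici.2 hs) hs
      simpa only [hu0 0 le_rfl] using this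
  have hNe := nehari_nonneg_of_curve hμ₁ hu hE hEn (by rw [hu0 0 le_rfl]; exact hD.le)
  have he := energy_pos_of_nehari_pos μ hD
  have hB : ∀ s, funB N (u s) ≤ δ₁ * quadA N μ (u s) := fun s =>
    funB_le_mul_quadA hμ₁ he hδ₁ (hEn s) (hNe s)
  -- For `δ₁ ≤ 1` the available factor is `(1 - δ₁) / 2`, and half of it is kept. For `δ₁ ≥ 1` the
  -- left side is nonpositive and `D_K ≥ 0` suffices.
  have hdecay : ∀ s, (1 - δ₁) / 4 * ‖fn (u s)‖ ^ 2 ≤ nehari N μ (u s) := by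
    intro s
    rcases le_total δ₁ 1 with h1 | h1
    · have h2 := norm_fn_sq_le_quadA hμ₁ (u s)
      have h3 := hB s
      have h4 : (1 - δ₁) * (1 / 2 * ‖fn (u s)‖ ^ 2) ≤ (1 - δ₁) * quadA N μ (u s) :=
        mul_le_mul_of_nonneg_left h2 (by linarith)
      have h5 : 0 ≤ (1 - δ₁) * ‖fn (u s)‖ ^ 2 := mul_nonneg (by linarith) (sq_nonneg _)
      rw [nehari]
      linarith
    · exact le_trans (mul_nonpos_of_nonpos_of_nonneg (by linarith) (sq_nonneg _)) (hNe s)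
  set c : ℝ := 1 / 2 * (1 - δ₁) with hc
  set y : ℝ → ℝ := fun s => 1 / 2 * ‖fnL N (u s) - fnL N 0‖ ^ 2 with hy
  have hyc : Continuous y := by fun_prop
  have hyv : ∀ s, y s = 1 / 2 * ‖fn (u s)‖ ^ 2 := fun s => by
    simp only [hy, map_zero, sub_zero, fnL_apply]
  have hyd : ∀ s, 0 < s → HasDerivAt y (-nehari N μ (u s)) s := by
    intro s hs
    -- With reference point `0` the derivative is `E_K'(u)(-u) = -D_K(u)`.
    have h := hasDerivAt_half_norm_sub_sq hu hG hflow 0 hs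
    rwa [zero_sub, map_neg, energyDeriv_self] at h
  have hmono : AntitoneOn (fun s => y s * Real.exp (c * s)) (Ici 0) := by
    refine antitoneOn_of_hasDerivWithinAt_nonpos (convex_Ici 0)
      (f' := fun s => -nehari N μ (u s) * Real.exp (c * s) + y s * (Real.exp (c * s) * c))
      (by fun_prop) ?_ ?_
    · intro s hs
      rw [interior_Ici] at hs
      have h2 : HasDerivAt (fun s => Real.exp (c * s)) (Real.exp (c * s) * c) s := by
        simpa using ((hasDerivAt_id s).const_mul c).exp
      exact ((hyd s hs).mul h2).hasDerivWithinAt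
    · intro s _
      have h1 := hdecay s
      have h2 := Real.exp_pos (c * s)
      have h3 : y s * c ≤ nehari N μ (u s) := by
        rw [hyv, hc]
        linarith
      nlinarith
  have h1 := hmono (mem_Ici.2 le_rfl) (mem_Ici.2 hs) hs
  simp only [hyv, mul_zero, Real.exp_zero, mul_one, hu0 0 le_rfl, huv s hs] at h1
  have h2 : Real.exp (-(1 / 2) * (1 - δ₁) * s) = (Real.exp (c * s))⁻¹ := by
    rw [← Real.exp_neg, hc]
    congr 1
    ring
  rw [h2, ← div_eq_mul_inv, le_div_iff₀ (Real.exp_pos _)]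
  linarith

end Ge3

end HardySobolev

end

theorem theorem3p4 (N : ℕ) (hN : 3 ≤ N) (μ : ℝ) (hμ₀ : 0 ≤ μ) (hμ₁ : μ ≤ ((N : ℝ) - 2) ^ 2 / 8)
    (v₀ : HardySobolev.X N)
    (hE : (HardySobolev.energy N μ v₀ : EReal) < HardySobolev.depth N μ)
    (hD : 0 < HardySobolev.nehari N μ v₀)
    (δ₁ δ₂ : ℝ) (hδ : δ₁ < δ₂)
    (hδ₁ : HardySobolev.depthMod N μ δ₁ = (HardySobolev.energy N μ v₀ : EReal))
    (hδ₂ : HardySobolev.depthMod N μ δ₂ = (HardySobolev.energy N μ v₀ : EReal))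
    (v : ℝ → HardySobolev.X N) (hv : HardySobolev.IsGlobalWeakSolution N μ v₀ v) :
    ∀ s : ℝ, 0 ≤ s →
      ‖HardySobolev.fn (v s)‖ ^ 2 ≤
        ‖HardySobolev.fn v₀‖ ^ 2 * Real.exp (-(1 / 2) * (1 - δ₁) * s) := by
  have : Fact (3 ≤ N) := ⟨hN⟩
  exact hv.norm_fn_sq_le hμ₁ hE hD hδ₁
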